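/- **Model.** In the mistake-bound model for the class $\mathrm{PAR}(k)$ of $k$-parities on $n$ variables, a target $x\in\{0,1\}^n$ of Hamming weight $k$ is hidden. In each round the learner receives an arbitrary example $a\in\{0,1\}^n$, predicts $\langle a,x\rangle=\sum_i a_ix_i \pmod 2$, and is then told the true value. Its mistake bound is the maximal total number of wrong predictions over all targets and all infinite sequences of examples. A learning algorithm for a given $n$ is a deterministic program for a random access machine (registers holding natural numbers, initially all $0$; constants, addition, truncated subtraction, indirect load and store, conditional jump, and access to a chosen coordinate of the current example) which keeps its memory from round to round. Running time is measured by logarithmic cost: each executed instruction costs $1$ plus the number of binary digits of all its arguments and of the register contents that it handles. The running time of a round is the total cost of all instructions executed in that round, any initialization being counted in the first round. The size of a program is the number of bits needed to write it down, i.e. the sum over its instructions of $1$ plus the number of binary digits of the arguments. We write $f=\tilde O(g)$ if $f=O(g\cdot(\log g)^{C})$ for some constant $C$, and $u(n)\ll v(n)$ if $u(n)=o(v(n))$ as $n\to\infty$. **Theorem.** Let $k,t:\mathbb N\to\mathbb N$ be functions such that $\log\log n\ll k(n)\ll t(n)\ll n$. Then there are functions $\varepsilon,g:\mathbb N\to\mathbb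 R$ with $\varepsilon(n)\to0$ and $g(n)=\tilde O\big((k(n)\,n/t(n))^2\big)$ such that for every $n\in\mathbb N$ with $k(n)\le t(n)$ (hence for all sufficiently large $n$) there is an algorithm that learns $\mathrm{PAR}(k(n))$ on $n$ variables in the mistake-bound model with mistake bound at most $$(1+\varepsilon(n))\,\frac{k(n)\,n}{t(n)}+\log_2\binom{t(n)}{k(n)}$$ and with running time in each round at most $$e^{-k(n)/4.01}\cdot\binom{t(n)}{k(n)}\cdot g(n),$$ where the size of the program is also at most the latter quantity. -/

import Mathlib

open Filter Topology Asymptotics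

/-! ### A random access machine with logarithmic cost, interacting with a teacher -/

namespace ParityRAM

/-- Number of binary digits of `x` (with one digit for `0`). -/
def len (x : ℕ) : ℕ := Nat.log 2 x + 1

/-- Instructions of a random access machine whose registers `R 0, R 1, …` hold natural numbers.
* `const i c`    : `R i := c`
* `add i j l`    : `R i := R j + R l`
* `sub i j l`    : `R i := max (R j - R l) 0`
* `load i j`     : `R i := R (R j)`
* `store i j`    : `R (R i) := R j`
* `jumpZero i p` : if `R i = 0`, continue with instruction number `p`
* `query i j`    : `R i :=` coordinate number `R j` of the current example (`0` if out of range)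
* `predict i`    : announce a prediction for the label of the current example
  (`0` if `R i = 0`, and `1` otherwise), and receive the true label in `R i`
* `next`         : end the current round and receive the next example. -/
inductive Instr where
  | const (i c : ℕ)
  | add (i j l : ℕ)
  | sub (i j l : ℕ)
  | load (i j : ℕ)
  | store (i j : ℕ)
  | jumpZero (i p : ℕ)
  | query (i j : ℕ)
  | predict (i : ℕ)
  | next

/-- A program is a finite list of instructions, numbered from `0`. -/
abbrev Program := List Instr

/-- The program counter and the contents of the registers. -/
structure Config where
  pc : ℕ
  reg : ℕ → ℕ

/-- The machine starts at instruction `0` with all registers `0`. -/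
def Config.start : Config := ⟨0, fun _ => 0⟩

/-- Put `v` into register `i` and go on to the following instruction. -/
def Config.put (c : Config) (i v : ℕ) : Config := ⟨c.pc + 1, Function.update c.reg i v⟩

/-- The number of bits needed to write an instruction down: one unit for the operation, and the
number of binary digits of each of its arguments. -/
def Instr.size : Instr → ℕ
  | const i c => 1 + len i + len c
  | add i j l => 1 + len i + len j + len l
  | sub i j l => 1 + len i + len j + len l
  | load i j => 1 + len i + len j
  | store i j => 1 + len i + len j
  | jumpZero i p => 1 + len i + len p
  | query i j => 1 + len i + len j
  | predict i => 1 + len i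
  | next => 1

/-- The size of a program: the total size of its instructions. -/
def Program.size (P : Program) : ℕ := (P.map Instr.size).sum

/-- The logarithmic cost of executing an instruction: its size, plus the number of binary digits of
each of the register contents that it handles. -/
def Instr.cost (R : ℕ → ℕ) : Instr → ℕ
  | const i c => (const i c).size
  | add i j l => (add i j l).size + len (R j) + len (R l)
  | sub i j l => (sub i j l).size + len (R j) + len (R l)
  | load i j => (load i j).size + len (R j) + len (R (R j))
  | store i j => (store i j).size + len (R i) + len (R j)
  | jumpZero i p => (jumpZero i p).size + len (R i)
  | query i j => (query i j).size + len (R j)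
  | predict i => (predict i).size + len (R i)
  | next => next.size

/-- The effect of an internal instruction while the current example is `a`. The two instructions
`predict` and `next`, which interact with the teacher, are not internal. -/
def Instr.step {n : ℕ} (a : Fin n → ZMod 2) (c : Config) : Instr → Option Config
  | const i v => some (c.put i v)
  | add i j l => some (c.put i (c.reg j + c.reg l))
  | sub i j l => some (c.put i (c.reg j - c.reg l))
  | load i j => some (c.put i (c.reg (c.reg j)))
  | store i j => some (c.put (c.reg i) (c.reg j))
  | jumpZero i p => some ⟨if c.reg i = 0 then p else c.pc + 1, c.reg⟩
  | query i j => some (c.put i (if h : c.reg j < n then (a ⟨c.reg j, h⟩).val else 0))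
  | predict _ => none
  | next => none

/-- `Reaches P a c T c'`: while the current example is `a`, the program `P` gets from `c` to `c'`
by executing internal instructions of total cost `T`. -/
inductive Reaches (P : Program) {n : ℕ} (a : Fin n → ZMod 2) : Config → ℕ → Config → Prop
  | refl (c : Config) : Reaches P a c 0 c
  | head {c c₁ c' : Config} {T : ℕ} {I : Instr} (hI : P[c.pc]? = some I)
      (hstep : I.step a c = some c₁) (h : Reaches P a c₁ T c') :
      Reaches P a c (I.cost c.reg + T) c'

/-- `Round P a y c b T c'`: in a round with example `a` and true label `y` that begins in `c`, the
program predicts `b`, is then told `y`, and ends the round in `c'`; the total cost of all the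
instructions executed in the round is `T`. -/
def Round (P : Program) {n : ℕ} (a : Fin n → ZMod 2) (y : ZMod 2)
    (c : Config) (b : ZMod 2) (T : ℕ) (c' : Config) : Prop :=
  ∃ (c₁ c₂ : Config) (T₁ T₂ i : ℕ),
    Reaches P a c T₁ c₁ ∧
    P[c₁.pc]? = some (Instr.predict i) ∧
    b = (if c₁.reg i = 0 then 0 else 1) ∧
    Reaches P a (c₁.put i y.val) T₂ c₂ ∧
    P[c₂.pc]? = some Instr.next ∧
    c' = ⟨c₂.pc + 1, c₂.reg⟩ ∧
    T = T₁ + (Instr.predict i).cost c₁.reg + T₂ + Instr.next.cost c₂.reg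

/-- `P` learns the class of parities `a ↦ ∑ i, a i * x i` (mod 2) on `n` variables with `x` of
Hamming weight `k` in the mistake-bound model, with mistake bound `M` and running time at most `τ`
in each round: for every target `x` and every infinite sequence of examples `a 0, a 1, …`, the
program (started once, and keeping its memory from round to round) completes every round at cost at
most `τ`, and altogether it makes at most `M` mistakes. -/
def LearnsParities (P : Program) (n k : ℕ) (M τ : ℝ) : Prop :=
  ∀ x : Fin n → ZMod 2, hammingNorm x = k → ∀ a : ℕ → Fin n → ZMod 2,
    ∃ (c : ℕ → Config) (b : ℕ → ZMod 2) (T : ℕ → ℕ),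
      c 0 = Config.start ∧
      (∀ j, Round P (a j) (a j ⬝ᵥ x) (c j) (b j) (T j) (c (j + 1))) ∧
      (∀ j, (T j : ℝ) ≤ τ) ∧
      ∀ r : ℕ, (((Finset.range r).filter fun j => b j ≠ a j ⬝ᵥ x).card : ℝ) ≤ M

end ParityRAM

/-- `f = Õ(g)` as `n → ∞`: `f = O(g · (log g) ^ C)` for some constant `C`. -/
def IsSoftO (f g : ℕ → ℝ) : Prop :=
  ∃ C : ℕ, f =O[atTop] fun n => g n * Real.log (g n) ^ C

namespace ParityRAM

/-! ### Straight-line code -/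

/-! The learner is a halving algorithm whose hypothesis class is a union of affine spaces. Suppose
that `N` sets of at most `m` coordinates cover all `k`-sets of coordinates. For each of them keep an
affine space over `ZMod 2` of candidate targets supported there, at first all of them, with weight
two to the dimension. On a given example the label is either constant on a space, which then votes
with its full weight, or splits it into equal halves, and then it abstains. The prediction is the
weighted majority; afterwards each space is cut with the hyperplane given by the true label. A wrong
prediction at least halves the total weight (`IsRound.two_mul_weight`,
`IsRound.two_mul_sum_weight_le`). The weight starts at `N * 2 ^ m` and never drops below 1, since a
space containing the target survives (`IsRound.covers`). Hence there are at most `m + log₂ N`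
mistakes (`exists_learner`).

For the covering, cut the coordinates into `2 * t` blocks of length about `n / (2 * t)` and use
unions of `2 * k` blocks, so `m` is about `k * n / t`. A greedy choice (`exists_covering_design`)
needs only `(2t choose k) / (2k choose k)` such unions up to a logarithmic factor, which is roughly
`2 ^ (-k) * (t choose k)`. This leaves exponential room below `exp (-k / 4.01) * (t choose k)`, and
the room absorbs all powers of `k` and of `log n`, because `log log n = o(k)`. What remains of the
cost `N * m ^ 2` of a round is the factor `(k * n / t) ^ 2`.

On the machine, a round is straight-line code followed by a jump back to the start. So each round
executes essentially every instruction once, and program size is bounded by running time. The code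
is specified by acyclic defining equations for variables; `exists_schedule` turns them into
assignments, and the correctness proof uses only the equations (`IsRound`). -/

theorem len_le_of_lt {x b : ℕ} (hb : 1 ≤ b) (h : x < 2 ^ b) : len x ≤ b := by
  unfold len
  rcases Nat.eq_zero_or_pos x with rfl | hx
  · simpa using hb
  · exact Nat.log_lt_of_lt_pow hx.ne' h

theorem Reaches.trans {P : Program} {n : ℕ} {a : Fin n → ZMod 2} {c c' c'' : Config} {T T' : ℕ}
    (h : Reaches P a c T c') (h' : Reaches P a c' T' c'') : Reaches P a c (T + T') c'' := by
  induction h with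
  | refl c => simpa using h'
  | head hI hs _ ih => rw [Nat.add_assoc]; exact Reaches.head hI hs (ih h')

/-- `Runs a code R T R'`: wherever the block `code` stands in a program, it runs from its beginning
to its end, turning the registers `R` into `R'` at cost `T`. -/
def Runs {n : ℕ} (a : Fin n → ZMod 2) (code : Program) (R : ℕ → ℕ) (T : ℕ) (R' : ℕ → ℕ) : Prop :=
  ∀ pre post : Program,
    Reaches (pre ++ code ++ post) a ⟨pre.length, R⟩ T ⟨pre.length + code.length, R'⟩

theorem Runs.nil {n : ℕ} (a : Fin n → ZMod 2) (R : ℕ → ℕ) : Runs a [] R 0 R :=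
  fun _ _ => Reaches.refl _

theorem Runs.append {n : ℕ} {a : Fin n → ZMod 2} {p q : Program} {R R' R'' : ℕ → ℕ} {T T' : ℕ}
    (h : Runs a p R T R') (h' : Runs a q R' T' R'') : Runs a (p ++ q) R (T + T') R'' := by
  intro pre post
  have h₁ := h pre (q ++ post)
  have h₂ := h' (pre ++ p) post
  simp only [List.append_assoc, List.length_append] at h₁ h₂ ⊢
  rw [← Nat.add_assoc]
  exact h₁.trans h₂

theorem Runs.single {n : ℕ} {a : Fin n → ZMod 2} {I : Instr} {R R' : ℕ → ℕ}
    (h : ∀ p, I.step a ⟨p, R⟩ = some ⟨p + 1, R'⟩) : Runs a [I] R (I.cost R) R' := by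
  intro pre post
  have hI : (pre ++ [I] ++ post)[(⟨pre.length, R⟩ : Config).pc]? = some I := by simp
  simpa using Reaches.head hI (h pre.length) (Reaches.refl _)

/-! ### Variables and expressions -/

/-- Names of the variables of the learning program. The variables `tab e` form a table to which
there is indirect access, the variables `bit g i j l` hold bits, and the variables `num g i` hold
numbers. -/
inductive Var where
  | tab (e : ℕ)
  | bit (g i j l : ℕ)
  | num (g i : ℕ)
  deriving DecidableEq

/-- The register that holds a variable. Register `0` is always `0`, and the registers `4 * s + 1`
hold intermediate results. -/
def Var.reg : Var → ℕ
  | tab e => 4 * e + 2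
  | bit g i j l => 4 * Nat.pair (Nat.pair g i) (Nat.pair j l) + 3
  | num g i => 4 * Nat.pair g i + 4

/-- The registers for intermediate results. -/
def tmp (s : ℕ) : ℕ := 4 * s + 1

theorem Var.reg_injective : Function.Injective Var.reg := by
  intro v w h
  cases v <;> cases w <;> simp only [Var.reg] at h <;> first
    | omega
    | (have h := Nat.eq_of_mul_eq_mul_left (by norm_num) (Nat.add_right_cancel h)
       grind [Nat.pair_eq_pair])

theorem Var.reg_ne_tmp (v : Var) (s : ℕ) : v.reg ≠ tmp s := by
  cases v <;> simp only [Var.reg, tmp] <;> omega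

theorem Var.reg_ne_zero (v : Var) : v.reg ≠ 0 := by
  cases v <;> simp [Var.reg]

theorem tmp_ne_zero (s : ℕ) : tmp s ≠ 0 := by simp [tmp]

/-- Expressions over the variables and the coordinates of the current example. -/
inductive Expr where
  | var (v : Var)
  | lit (c : ℕ)
  | add (e f : Expr)
  | sub (e f : Expr)
  | query (c : ℕ)
  | load (e : Expr)

/-- Coordinate `c` of the example `a`, and `0` if `c` is out of range. -/
def coord {n : ℕ} (a : Fin n → ZMod 2) (c : ℕ) : ℕ := if h : c < n then (a ⟨c, h⟩).val else 0

namespace Expr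

/-- The value of an expression. -/
def eval {n : ℕ} (a : Fin n → ZMod 2) (M : Var → ℕ) : Expr → ℕ
  | var v => M v
  | lit c => c
  | add e f => eval a M e + eval a M f
  | sub e f => eval a M e - eval a M f
  | query c => coord a c
  | load e => M (.tab (eval a M e))

/-- Code that evaluates an expression into the register `tmp s`. -/
def compile : Expr → ℕ → Program
  | var v, s => [.add (tmp s) v.reg 0]
  | lit c, s => [.const (tmp s) c]
  | add e f, s => compile e s ++ (compile f (s + 1) ++ [.add (tmp s) (tmp s) (tmp (s + 1))])
  | sub e f, s => compile e s ++ (compile f (s + 1) ++ [.sub (tmp s) (tmp s) (tmp (s + 1))])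
  | query c, s => [.const (tmp s) c] ++ [.query (tmp s) (tmp s)]
  | load e, s => compile e s ++ ([.add (tmp s) (tmp s) (tmp s)] ++ ([.add (tmp s) (tmp s) (tmp s)]
      ++ ([.const (tmp (s + 1)) 2] ++ ([.add (tmp s) (tmp s) (tmp (s + 1))]
      ++ [.load (tmp s) (tmp s)]))))

/-- The number of instructions of the code of an expression. -/
def count : Expr → ℕ
  | var _ => 1
  | lit _ => 1
  | add e f => count e + count f + 1
  | sub e f => count e + count f + 1
  | query _ => 2
  | load e => count e + 5

/-- The number of additional registers needed for intermediate results. -/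
def depth : Expr → ℕ
  | var _ => 0
  | lit _ => 0
  | add e f => max (depth e) (depth f + 1)
  | sub e f => max (depth e) (depth f + 1)
  | query _ => 0
  | load e => max (depth e) 1

/-- An upper bound for the value of an expression when the variables are bounded by `β`. -/
def ub (β : Var → ℕ) : Expr → ℕ
  | var v => β v
  | lit c => c
  | add e f => ub β e + ub β f
  | sub e _ => ub β e
  | query _ => 1
  | load _ => β (.tab 0)

/-- All numbers handled in the evaluation of an expression have at most `b` binary digits. -/
def Fits (β : Var → ℕ) (b : ℕ) : Expr → Prop
  | var v => v.reg < 2 ^ b ∧ β v < 2 ^ b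
  | lit c => c < 2 ^ b
  | add e f => Fits β b e ∧ Fits β b f ∧ ub β e + ub β f < 2 ^ b
  | sub e f => Fits β b e ∧ Fits β b f
  | query c => c < 2 ^ b
  | load e => Fits β b e ∧ 4 * ub β e + 2 < 2 ^ b ∧ β (.tab 0) < 2 ^ b

/-- The variables that may be read in the evaluation of an expression. -/
def Reads (β : Var → ℕ) : Expr → Var → Prop
  | var v, w => w = v
  | lit _, _ => False
  | add e f, w => Reads β e w ∨ Reads β f w
  | sub e f, w => Reads β e w ∨ Reads β f w
  | query _, _ => False
  | load e, w => Reads β e w ∨ ∃ r ≤ ub β e, w = .tab r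

theorem coord_le {n : ℕ} (a : Fin n → ZMod 2) (c : ℕ) : coord a c ≤ 1 := by
  unfold coord
  split
  · exact Nat.le_of_lt_succ (ZMod.val_lt _)
  · simp

theorem eval_le_ub {n : ℕ} (a : Fin n → ZMod 2) {β M : Var → ℕ} (hM : ∀ v, M v ≤ β v)
    (hβ : ∀ e, β (.tab e) ≤ β (.tab 0)) (e : Expr) : e.eval a M ≤ e.ub β := by
  induction e with
  | var v => exact hM v
  | lit c => exact le_rfl
  | add e f he hf => exact Nat.add_le_add he hf
  | sub e f he hf => exact (Nat.sub_le _ _).trans he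
  | query c => exact coord_le a c
  | load e he => exact (hM _).trans (hβ _)

theorem eval_congr {n : ℕ} (a : Fin n → ZMod 2) {β M M' : Var → ℕ} (hM : ∀ v, M v ≤ β v)
    (hβ : ∀ e, β (.tab e) ≤ β (.tab 0)) (e : Expr) (h : ∀ w, e.Reads β w → M w = M' w) :
    e.eval a M = e.eval a M' := by
  induction e with
  | var v => exact h v rfl
  | lit c => rfl
  | add e f he hf =>
    exact congrArg₂ (· + ·) (he fun w hw => h w (.inl hw)) (hf fun w hw => h w (.inr hw))
  | sub e f he hf =>
    exact congrArg₂ (· - ·) (he fun w hw => h w (.inl hw)) (hf fun w hw => h w (.inr hw))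
  | query c => rfl
  | load e he =>
    have := he fun w hw => h w (.inl hw)
    simp only [eval]
    rw [← this]
    exact h _ (.inr ⟨_, eval_le_ub a hM hβ e, rfl⟩)

theorem ub_lt_of_fits {β : Var → ℕ} {b : ℕ} (hb : 1 ≤ b) {e : Expr} (h : e.Fits β b) :
    e.ub β < 2 ^ b := by
  induction e with
  | var v => exact h.2
  | lit c => exact h
  | add e f he hf => exact h.2.2
  | sub e f he hf => exact he h.1
  | query c => exact Nat.one_lt_two_pow (by omega)
  | load e he => exact h.2.2

end Expr

/-! ### Costs of single instructions and of compiled expressions. -/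

theorem Instr.size_const_le {b i c : ℕ} (hb : 1 ≤ b) (hi : i < 2 ^ b) (hc : c < 2 ^ b) :
    (Instr.const i c).size ≤ 6 * b := by
  have := len_le_of_lt hb hi
  have := len_le_of_lt hb hc
  simp only [Instr.size]; omega

theorem Instr.cost_const_le {b i c : ℕ} (R : ℕ → ℕ) (hb : 1 ≤ b) (hi : i < 2 ^ b)
    (hc : c < 2 ^ b) : (Instr.const i c).cost R ≤ 6 * b :=
  Instr.size_const_le hb hi hc

theorem Instr.cost_add_le {b i j l : ℕ} {R : ℕ → ℕ} (hb : 1 ≤ b) (hi : i < 2 ^ b)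
    (hj : j < 2 ^ b) (hl : l < 2 ^ b) (hRj : R j < 2 ^ b) (hRl : R l < 2 ^ b) :
    (Instr.add i j l).cost R ≤ 6 * b := by
  have := len_le_of_lt hb hi
  have := len_le_of_lt hb hj
  have := len_le_of_lt hb hl
  have := len_le_of_lt hb hRj
  have := len_le_of_lt hb hRl
  simp only [Instr.cost, Instr.size]; omega

theorem Instr.cost_sub_le {b i j l : ℕ} {R : ℕ → ℕ} (hb : 1 ≤ b) (hi : i < 2 ^ b)
    (hj : j < 2 ^ b) (hl : l < 2 ^ b) (hRj : R j < 2 ^ b) (hRl : R l < 2 ^ b) :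
    (Instr.sub i j l).cost R ≤ 6 * b := by
  have := len_le_of_lt hb hi
  have := len_le_of_lt hb hj
  have := len_le_of_lt hb hl
  have := len_le_of_lt hb hRj
  have := len_le_of_lt hb hRl
  simp only [Instr.cost, Instr.size]; omega

theorem Instr.cost_load_le {b i j : ℕ} {R : ℕ → ℕ} (hb : 1 ≤ b) (hi : i < 2 ^ b)
    (hj : j < 2 ^ b) (hRj : R j < 2 ^ b) (hRR : R (R j) < 2 ^ b) :
    (Instr.load i j).cost R ≤ 6 * b := by
  have := len_le_of_lt hb hi
  have := len_le_of_lt hb hj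
  have := len_le_of_lt hb hRj
  have := len_le_of_lt hb hRR
  simp only [Instr.cost, Instr.size]; omega

theorem Instr.cost_query_le {b i j : ℕ} {R : ℕ → ℕ} (hb : 1 ≤ b) (hi : i < 2 ^ b)
    (hj : j < 2 ^ b) (hRj : R j < 2 ^ b) : (Instr.query i j).cost R ≤ 6 * b := by
  have := len_le_of_lt hb hi
  have := len_le_of_lt hb hj
  have := len_le_of_lt hb hRj
  simp only [Instr.cost, Instr.size]; omega

theorem Program.size_append (p q : Program) :
    Program.size (p ++ q) = Program.size p + Program.size q := by
  simp [Program.size]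

theorem Instr.size_le_cost (I : Instr) (R : ℕ → ℕ) : I.size ≤ I.cost R := by
  cases I <;> simp [Instr.cost] <;> omega

/-- The limits fit together because `4 * 60 + 1 < 2 ^ 8`. -/
theorem tmp_lt {b s : ℕ} (hb : 8 ≤ b) (hs : s ≤ 60) : tmp s < 2 ^ b := by
  have : 2 ^ 8 ≤ 2 ^ b := Nat.pow_le_pow_right (by norm_num) hb
  simp only [tmp]; omega

/-- The registers `R'` arise from `R` by changes of the registers `tmp s'` with `s ≤ s'` only. -/
def Keeps (s : ℕ) (R R' : ℕ → ℕ) : Prop := ∀ r, (∀ s', s ≤ s' → r ≠ tmp s') → R' r = R r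

theorem Keeps.trans {s : ℕ} {R R' R'' : ℕ → ℕ} (h : Keeps s R R') (h' : Keeps s R' R'') :
    Keeps s R R'' := fun r hr => (h' r hr).trans (h r hr)

theorem Keeps.mono {s s' : ℕ} {R R' : ℕ → ℕ} (h : Keeps s' R R') (hs : s ≤ s') : Keeps s R R' :=
  fun r hr => h r fun q hq => hr q (hs.trans hq)

theorem Keeps.update {s s' : ℕ} (R : ℕ → ℕ) (v : ℕ) (hs : s ≤ s') :
    Keeps s R (Function.update R (tmp s') v) := fun _ hr =>
  Function.update_of_ne (hr s' hs) _ _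

theorem Keeps.reg {s : ℕ} {R R' : ℕ → ℕ} (h : Keeps s R R') (v : Var) : R' v.reg = R v.reg :=
  h _ fun s' _ => v.reg_ne_tmp s'

theorem Keeps.zero {s : ℕ} {R R' : ℕ → ℕ} (h : Keeps s R R') : R' 0 = R 0 :=
  h _ fun s' _ => (tmp_ne_zero s').symm

theorem Keeps.tmp {s s' : ℕ} {R R' : ℕ → ℕ} (h : Keeps s R R') (hs : s' < s) :
    R' (tmp s') = R (tmp s') :=
  h _ fun q hq => by simp only [ParityRAM.tmp]; omega

/-- The index `s` acts as a stack pointer: the second operand is evaluated from `tmp (s + 1)` on and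
so cannot destroy the first. No instruction is skipped, so the code is no larger than its cost; the
bound on the program size comes from this. -/
theorem Expr.compile_runs {n : ℕ} (a : Fin n → ZMod 2) {β : Var → ℕ} {b : ℕ} (hb : 8 ≤ b)
    (hβ : ∀ e, β (.tab e) ≤ β (.tab 0)) (e : Expr) (hfit : e.Fits β b) (s : ℕ)
    (hs : s + e.depth ≤ 60) (R : ℕ → ℕ) (h0 : R 0 = 0) (hR : ∀ v : Var, R v.reg ≤ β v) :
    ∃ T R', Runs a (e.compile s) R T R' ∧ T ≤ 6 * b * e.count ∧
      (e.compile s).size ≤ T ∧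
      R' (tmp s) = e.eval a (fun v => R v.reg) ∧ Keeps s R R' := by
  have hb1 : 1 ≤ b := by omega
  have h0b : 0 < 2 ^ b := by positivity
  have hpow : 2 ^ 8 ≤ 2 ^ b := Nat.pow_le_pow_right (by norm_num) hb
  induction e generalizing s R with
  | var v =>
    refine ⟨_, Function.update R (tmp s) (R v.reg + R 0), Runs.single fun p => rfl, ?_, ?_, ?_,
      Keeps.update _ _ le_rfl⟩
    · simp only [Expr.count, Nat.mul_one]
      exact Instr.cost_add_le hb1 (tmp_lt hb (by omega)) hfit.1 h0b ((hR v).trans_lt hfit.2)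
        (by omega)
    · simpa [Program.size, Expr.compile] using Instr.size_le_cost _ _
    · simp [Expr.eval, h0]
  | lit c =>
    refine ⟨_, Function.update R (tmp s) c, Runs.single fun p => rfl, ?_, ?_, ?_,
      Keeps.update _ _ le_rfl⟩
    · simp only [Expr.count, Nat.mul_one]
      exact Instr.cost_const_le R hb1 (tmp_lt hb (by omega)) hfit
    · simpa [Program.size, Expr.compile] using Instr.size_le_cost _ R
    · simp [Expr.eval]
  | add e f he hf =>
    have hd : s + e.depth ≤ 60 ∧ s + 1 + f.depth ≤ 60 := by simp only [Expr.depth] at hs; omega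
    obtain ⟨T₁, R₁, h₁, hT₁, hz₁, hv₁, hk₁⟩ := he hfit.1 s hd.1 R h0 hR
    obtain ⟨T₂, R₂, h₂, hT₂, hz₂, hv₂, hk₂⟩ := hf hfit.2.1 (s + 1) hd.2 R₁ (hk₁.zero.trans h0)
      (fun v => (hk₁.reg v).le.trans (hR v))
    have hv₁' : R₂ (tmp s) = e.eval a fun v => R v.reg := (hk₂.tmp (Nat.lt_succ_self s)).trans hv₁
    have hv₂' : R₂ (tmp (s + 1)) = f.eval a fun v => R v.reg := by
      rw [hv₂]; congr 1; exact funext fun v => hk₁.reg v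
    refine ⟨_, Function.update R₂ (tmp s) (R₂ (tmp s) + R₂ (tmp (s + 1))),
      h₁.append (h₂.append (Runs.single fun p => rfl)), ?_, ?_, ?_, hk₁.trans
        ((hk₂.mono (Nat.le_succ s)).trans (Keeps.update _ _ le_rfl))⟩
    · have hc : (Instr.add (tmp s) (tmp s) (tmp (s + 1))).cost R₂ ≤ 6 * b := by
        refine Instr.cost_add_le hb1 (tmp_lt hb (by omega)) (tmp_lt hb (by omega))
          (tmp_lt hb (by omega)) ?_ ?_
        · rw [hv₁']
          exact (Expr.eval_le_ub a hR hβ e).trans_lt (Expr.ub_lt_of_fits hb1 hfit.1)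
        · rw [hv₂']
          exact (Expr.eval_le_ub a hR hβ f).trans_lt (Expr.ub_lt_of_fits hb1 hfit.2.1)
      simp only [Expr.count, Nat.mul_add]; omega
    · have := Instr.size_le_cost (Instr.add (tmp s) (tmp s) (tmp (s + 1))) R₂
      simp only [Expr.compile, Program.size_append]
      simp only [Program.size, List.map, List.sum_cons, List.sum_nil] at *
      omega
    · simp [Expr.eval, hv₁', hv₂']
  | sub e f he hf =>
    have hd : s + e.depth ≤ 60 ∧ s + 1 + f.depth ≤ 60 := by simp only [Expr.depth] at hs; omega
    obtain ⟨T₁, R₁, h₁, hT₁, hz₁, hv₁, hk₁⟩ := he hfit.1 s hd.1 R h0 hR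
    obtain ⟨T₂, R₂, h₂, hT₂, hz₂, hv₂, hk₂⟩ := hf hfit.2 (s + 1) hd.2 R₁ (hk₁.zero.trans h0)
      (fun v => (hk₁.reg v).le.trans (hR v))
    have hv₁' : R₂ (tmp s) = e.eval a fun v => R v.reg := (hk₂.tmp (Nat.lt_succ_self s)).trans hv₁
    have hv₂' : R₂ (tmp (s + 1)) = f.eval a fun v => R v.reg := by
      rw [hv₂]; congr 1; exact funext fun v => hk₁.reg v
    refine ⟨_, Function.update R₂ (tmp s) (R₂ (tmp s) - R₂ (tmp (s + 1))),
      h₁.append (h₂.append (Runs.single fun p => rfl)), ?_, ?_, ?_, hk₁.trans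
        ((hk₂.mono (Nat.le_succ s)).trans (Keeps.update _ _ le_rfl))⟩
    · have hc : (Instr.sub (tmp s) (tmp s) (tmp (s + 1))).cost R₂ ≤ 6 * b := by
        refine Instr.cost_sub_le hb1 (tmp_lt hb (by omega)) (tmp_lt hb (by omega))
          (tmp_lt hb (by omega)) ?_ ?_
        · rw [hv₁']
          exact (Expr.eval_le_ub a hR hβ e).trans_lt (Expr.ub_lt_of_fits hb1 hfit.1)
        · rw [hv₂']
          exact (Expr.eval_le_ub a hR hβ f).trans_lt (Expr.ub_lt_of_fits hb1 hfit.2)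
      simp only [Expr.count, Nat.mul_add]; omega
    · have := Instr.size_le_cost (Instr.sub (tmp s) (tmp s) (tmp (s + 1))) R₂
      simp only [Expr.compile, Program.size_append]
      simp only [Program.size, List.map, List.sum_cons, List.sum_nil] at *
      omega
    · simp [Expr.eval, hv₁', hv₂']
  | query c =>
    have hfit : c < 2 ^ b := hfit
    refine ⟨_, Function.update (Function.update R (tmp s) c) (tmp s) (coord a c),
      (Runs.single (R' := Function.update R (tmp s) c) fun p => rfl).append
        (Runs.single fun p => by simp [Instr.step, Config.put, coord]), ?_, ?_, ?_,
      (Keeps.update _ _ le_rfl).trans (Keeps.update _ _ le_rfl)⟩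
    · have h₁ := Instr.cost_const_le R hb1 (tmp_lt hb (by omega : s ≤ 60)) hfit
      have h₂ : (Instr.query (tmp s) (tmp s)).cost (Function.update R (tmp s) c) ≤ 6 * b :=
        Instr.cost_query_le hb1 (tmp_lt hb (by omega)) (tmp_lt hb (by omega)) (by simpa using hfit)
      simp only [Expr.count]; omega
    · have h₁ := Instr.size_le_cost (Instr.const (tmp s) c) R
      have h₂ := Instr.size_le_cost (Instr.query (tmp s) (tmp s)) (Function.update R (tmp s) c)
      simp only [Expr.compile, Program.size_append]
      simp only [Program.size, List.map, List.sum_cons, List.sum_nil] at *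
      omega
    · simp [Expr.eval]
  | load e he =>
    have hd : s + e.depth ≤ 60 ∧ s + 1 ≤ 60 := by simp only [Expr.depth] at hs; omega
    obtain ⟨T₁, R₁, h₁, hT₁, hz₁, hv₁, hk₁⟩ := he hfit.1 s hd.1 R h0 hR
    have hx := Expr.eval_le_ub a hR hβ e
    have hx' := hfit.2.1
    set x := e.eval a (fun v => R v.reg) with hxdef
    have hts : tmp (s + 1) ≠ tmp s := by simp [tmp]
    have ht : tmp s < 2 ^ b := tmp_lt hb (by omega)
    have ht' : tmp (s + 1) < 2 ^ b := tmp_lt hb (by omega)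
    -- Doubling twice and adding 2 produces the address `4 * x + 2` of `tab x`.
    let R₂ := Function.update R₁ (tmp s) (R₁ (tmp s) + R₁ (tmp s))
    let R₃ := Function.update R₂ (tmp s) (R₂ (tmp s) + R₂ (tmp s))
    let R₄ := Function.update R₃ (tmp (s + 1)) 2
    let R₅ := Function.update R₄ (tmp s) (R₄ (tmp s) + R₄ (tmp (s + 1)))
    let R₆ := Function.update R₅ (tmp s) (R₅ (R₅ (tmp s)))
    have e₂ : R₂ (tmp s) = 2 * x := by simp [R₂, hv₁]; omega
    have e₃ : R₃ (tmp s) = 4 * x := by simp [R₃, e₂]; omega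
    have e₄ : R₄ (tmp s) = 4 * x := by simp [R₄, hts.symm, e₃]
    have e₄' : R₄ (tmp (s + 1)) = 2 := by simp [R₄]
    have e₅ : R₅ (tmp s) = (Var.tab x).reg := by simp [R₅, e₄, e₄', Var.reg]
    have hk : Keeps s R R₅ := hk₁.trans ((Keeps.update _ _ le_rfl).trans
      ((Keeps.update _ _ le_rfl).trans ((Keeps.update _ _ (Nat.le_succ s)).trans
        (Keeps.update _ _ le_rfl))))
    have e₆ : R₅ (R₅ (tmp s)) = R (Var.tab x).reg := by rw [e₅]; exact hk.reg _
    have r₂ : Runs a [.add (tmp s) (tmp s) (tmp s)] R₁ _ R₂ := Runs.single fun p => rfl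
    have r₃ : Runs a [.add (tmp s) (tmp s) (tmp s)] R₂ _ R₃ := Runs.single fun p => rfl
    have r₄ : Runs a [.const (tmp (s + 1)) 2] R₃ _ R₄ := Runs.single fun p => rfl
    have r₅ : Runs a [.add (tmp s) (tmp s) (tmp (s + 1))] R₄ _ R₅ := Runs.single fun p => rfl
    have r₆ : Runs a [.load (tmp s) (tmp s)] R₅ _ R₆ := Runs.single fun p => rfl
    refine ⟨_, R₆, h₁.append (r₂.append (r₃.append (r₄.append (r₅.append r₆)))), ?_, ?_, ?_,
      hk.trans (Keeps.update _ _ le_rfl)⟩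
    · have c₂ := Instr.cost_add_le (R := R₁) hb1 ht ht ht (by omega) (by omega)
      have c₃ := Instr.cost_add_le (R := R₂) hb1 ht ht ht (by omega) (by omega)
      have c₄ := Instr.cost_const_le R₃ hb1 ht' (by omega : 2 < 2 ^ b)
      have c₅ := Instr.cost_add_le (R := R₄) hb1 ht ht ht' (by omega) (by omega)
      have c₆ := Instr.cost_load_le (R := R₅) hb1 ht ht (by rw [e₅]; simp only [Var.reg]; omega)
        (by rw [e₆]; exact (hR _).trans_lt ((hβ _).trans_lt hfit.2.2))
      simp only [Expr.count, Nat.mul_add]; omega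
    · have c₂ := Instr.size_le_cost (Instr.add (tmp s) (tmp s) (tmp s)) R₁
      have c₃ := Instr.size_le_cost (Instr.add (tmp s) (tmp s) (tmp s)) R₂
      have c₄ := Instr.size_le_cost (Instr.const (tmp (s + 1)) 2) R₃
      have c₅ := Instr.size_le_cost (Instr.add (tmp s) (tmp s) (tmp (s + 1))) R₄
      have c₆ := Instr.size_le_cost (Instr.load (tmp s) (tmp s)) R₅
      simp only [Expr.compile, Program.size_append]
      simp only [Program.size, List.map, List.sum_cons, List.sum_nil] at *
      omega
    · simp only [R₆, Function.update_self, e₆, Expr.eval, ← hxdef]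

/-- Code for the assignment `v := e`. -/
def assign (v : Var) (e : Expr) : Program := e.compile 0 ++ [.add v.reg (tmp 0) 0]

/-- `Sim a code M B M'`: the block `code` turns the values `M` of the variables into `M'` at cost at
most `B`. -/
def Sim {n : ℕ} (a : Fin n → ZMod 2) (code : Program) (M : Var → ℕ) (B : ℕ) (M' : Var → ℕ) :
    Prop :=
  ∀ R : ℕ → ℕ, R 0 = 0 → (∀ v : Var, R v.reg = M v) →
    ∃ T R', Runs a code R T R' ∧ T ≤ B ∧ code.size ≤ T ∧ R' 0 = 0 ∧ ∀ v : Var, R' v.reg = M' v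

theorem Sim.nil {n : ℕ} (a : Fin n → ZMod 2) (M : Var → ℕ) : Sim a [] M 0 M :=
  fun R h0 hR => ⟨0, R, Runs.nil a R, le_rfl, by simp [Program.size], h0, hR⟩

theorem Sim.append {n : ℕ} {a : Fin n → ZMod 2} {p q : Program} {M M' M'' : Var → ℕ} {B B' : ℕ}
    (h : Sim a p M B M') (h' : Sim a q M' B' M'') : Sim a (p ++ q) M (B + B') M'' := by
  intro R h0 hR
  obtain ⟨T, R', r, hT, hs, h0', hR'⟩ := h R h0 hR
  obtain ⟨T', R'', r', hT', hs', h0'', hR''⟩ := h' R' h0' hR'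
  exact ⟨_, R'', r.append r', Nat.add_le_add hT hT',
    by rw [Program.size_append]; exact Nat.add_le_add hs hs', h0'', hR''⟩

theorem sim_assign {n : ℕ} (a : Fin n → ZMod 2) {β M : Var → ℕ} {b : ℕ} (hb : 8 ≤ b)
    (hβ : ∀ e, β (.tab e) ≤ β (.tab 0)) (hM : ∀ v, M v ≤ β v) (v : Var) (e : Expr)
    (hfit : e.Fits β b) (hd : e.depth ≤ 60) (hv : v.reg < 2 ^ b) :
    Sim a (assign v e) M (6 * b * (e.count + 1)) (Function.update M v (e.eval a M)) := by
  intro R h0 hR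
  have hR' : (fun v : Var => R v.reg) = M := funext hR
  obtain ⟨T, R₁, r, hT, hs, hval, hk⟩ := e.compile_runs a hb hβ hfit 0 (by omega) R h0
    (fun v => (hR v).le.trans (hM v))
  rw [hR'] at hval
  have h0b : 0 < 2 ^ b := by positivity
  have hz : R₁ 0 = 0 := hk.zero.trans h0
  refine ⟨_, Function.update R₁ v.reg (R₁ (tmp 0) + R₁ 0), r.append (Runs.single fun p => rfl),
    ?_, ?_, ?_, ?_⟩
  · have : (Instr.add v.reg (tmp 0) 0).cost R₁ ≤ 6 * b :=
      Instr.cost_add_le (by omega) hv (tmp_lt hb (by omega)) h0b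
        (by rw [hval]
            exact (Expr.eval_le_ub a hM hβ e).trans_lt (Expr.ub_lt_of_fits (by omega) hfit))
        (by omega)
    rw [Nat.mul_add]; omega
  · have := Instr.size_le_cost (Instr.add v.reg (tmp 0) 0) R₁
    simp only [assign, Program.size_append]
    simp only [Program.size, List.map, List.sum_cons, List.sum_nil] at *
    omega
  · rw [Function.update_of_ne v.reg_ne_zero.symm, hz]
  · intro w
    rcases eq_or_ne w v with rfl | hw
    · simp [hval, hz]
    · rw [Function.update_of_ne hw, Function.update_of_ne (Var.reg_injective.ne hw), hk.reg, hR]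

/-- Assignments to a finite set of variables that do not depend on each other cyclically can be
ordered so that, after their execution, all of the defining equations hold. -/
theorem exists_schedule (X : Finset Var) (df : Var → Expr) (rank : Var → ℕ) {β : Var → ℕ}
    (b : Var → ℕ) (hβ : ∀ e, β (.tab e) ≤ β (.tab 0))
    (hacyc : ∀ v ∈ X, ∀ w ∈ X, (df v).Reads β w → rank w < rank v)
    (hub : ∀ v ∈ X, (df v).ub β ≤ β v) (hb : ∀ v ∈ X, 8 ≤ b v)
    (hfit : ∀ v ∈ X, (df v).Fits β (b v)) (hd : ∀ v ∈ X, (df v).depth ≤ 60)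
    (hreg : ∀ v ∈ X, v.reg < 2 ^ b v) :
    ∃ code : Program, ∀ {n : ℕ} (a : Fin n → ZMod 2) (M : Var → ℕ), (∀ v, M v ≤ β v) →
      ∃ M', Sim a code M (∑ v ∈ X, 6 * b v * ((df v).count + 1)) M' ∧ (∀ v, M' v ≤ β v) ∧
        (∀ v ∈ X, M' v = (df v).eval a M') ∧ ∀ v ∉ X, M' v = M v := by
  -- The variable of largest rank is assigned last. No defining expression in the set reads it, so
  -- the equations established earlier remain true.
  induction X using Finset.induction_on_max_value rank with
  | empty => exact ⟨[], fun a M hM => ⟨M, Sim.nil a M, hM, by simp, by simp⟩⟩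
  | insert v X hvX hmax ih =>
    obtain ⟨code, hcode⟩ := ih
      (fun u hu w hw => hacyc u (Finset.mem_insert_of_mem hu) w (Finset.mem_insert_of_mem hw))
      (fun u hu => hub u (Finset.mem_insert_of_mem hu))
      (fun u hu => hb u (Finset.mem_insert_of_mem hu))
      (fun u hu => hfit u (Finset.mem_insert_of_mem hu))
      (fun u hu => hd u (Finset.mem_insert_of_mem hu))
      (fun u hu => hreg u (Finset.mem_insert_of_mem hu))
    have hv := Finset.mem_insert_self v X
    refine ⟨code ++ assign v (df v), fun a M hM => ?_⟩
    obtain ⟨M', hsim, hM', heq, hne⟩ := hcode a M hM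
    have hcongr : ∀ u ∈ insert v X,
        (df u).eval a M' = (df u).eval a (Function.update M' v ((df v).eval a M')) := by
      intro u hu
      refine Expr.eval_congr a hM' hβ _ fun w hw => ?_
      rw [Function.update_of_ne]
      rintro rfl
      have h₁ := hacyc u hu w hv hw
      rcases Finset.mem_insert.1 hu with rfl | hu'
      · exact lt_irrefl _ h₁
      · exact absurd (hmax u hu') (not_le.2 h₁)
    refine ⟨Function.update M' v ((df v).eval a M'), ?_, ?_, ?_, ?_⟩
    · rw [Finset.sum_insert hvX, Nat.add_comm]
      exact hsim.append (sim_assign a (hb v hv) hβ hM' v _ (hfit v hv) (hd v hv) (hreg v hv))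
    · intro w
      rcases eq_or_ne w v with rfl | hw
      · rw [Function.update_self]
        exact (Expr.eval_le_ub a hM' hβ _).trans (hub w hv)
      · rw [Function.update_of_ne hw]; exact hM' w
    · intro w hw
      rw [← hcongr w hw]
      rcases eq_or_ne w v with rfl | hwv
      · rw [Function.update_self]
      · rw [Function.update_of_ne hwv]
        exact heq w (Finset.mem_of_mem_insert_of_ne hw hwv)
    · intro w hw
      rw [Finset.mem_insert, not_or] at hw
      rw [Function.update_of_ne hw.1]
      exact hne w hw.2

end ParityRAM

namespace ParityRAM

/-! ### The program -/

namespace Expr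

/-- Negation of a bit. -/
def neg (e : Expr) : Expr := sub (lit 1) e

/-- Exclusive disjunction of two bits. -/
def xor (e f : Expr) : Expr := sub (lit 1) (sub (lit 1) (add (sub e f) (sub f e)))

/-- Conjunction of two bits. -/
def and (e f : Expr) : Expr := sub (add e f) (lit 1)

/-- Disjunction of two bits. -/
def or (e f : Expr) : Expr := sub (lit 1) (sub (lit 1) (add e f))

/-- Exclusive disjunction of a bit with the entry `(j, l)` of the identity matrix. -/
def flipDiag (j l : ℕ) (e : Expr) : Expr := if j = l then neg e else e

/-- Coordinate `l` of the `j`-th vector of the `i`-th affine space. -/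
def vec (i j l : ℕ) : Expr := flipDiag j l (var (.bit 0 i j l))

/-- Table index of the weight that the `i`-th affine space gives to the prediction for which `q` is
`0`. -/
def vote (i m : ℕ) (q : Expr) : Expr :=
  -- The index is even exactly if the space is alive, decided, and `q` is 0. Odd entries of the
  -- table are 0, so this replaces a conditional jump.
  add (add (var (.num 0 i)) (var (.num 0 i)))
    (or (add (var (.bit 1 i 0 0)) q) (var (.bit 3 i m 0)))

end Expr

open ParityRAM.Expr

/-- The definitions of the variables computed before the prediction. The table contains
`2 ^ (m - d)` at index `2 * d` and `0` at odd indices. The variable `bit 0 i j l` is coordinate `l`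
of the `j`-th vector of the `i`-th affine space (up to addition of the identity matrix), `bit 1 i`
tells whether this space has been discarded, and `num 0 i` counts how often its dimension has
decreased. The remaining variables hold scalar products (`bit 2`), the information whether a scalar
product is nonzero (`bit 3`), the total weights of the two predictions (`num 2` and `num 3`), and
their comparison (`num 4`). -/
def beforeLabel (N m : ℕ) (σ : ℕ → ℕ → ℕ) : Var → Expr
  | .tab e => if e = 2 * m then lit 1 else add (var (.tab (e + 2))) (var (.tab (e + 2)))
  | .bit 2 i j (l + 1) => xor (var (.bit 2 i j l)) (and (query (σ i l)) (vec i j l))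
  | .bit 3 i (j + 1) _ => or (var (.bit 3 i j 0)) (var (.bit 2 i j m))
  | .num 2 (i + 1) => add (var (.num 2 i)) (load (vote i m (var (.bit 2 i m m))))
  | .num 3 (i + 1) => add (var (.num 3 i)) (load (vote i m (neg (var (.bit 2 i m m)))))
  | .num 4 _ => sub (var (.num 3 N)) (var (.num 2 N))
  | _ => lit 0

/-- The definitions of the variables computed after the label has been revealed in `num 4 0`: the
pivot vector (`bit 4`), and the new values of `bit 0`, `bit 1` and `num 0`. -/
def afterLabel (m : ℕ) : Var → Expr
  -- The double subtraction is `min m _`, which makes the bound `m` evident; by `Inv.rank` the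
  -- minimum never takes effect.
  | .num 1 i => sub (lit m) (sub (lit m) (add (var (.num 0 i)) (var (.bit 3 i m 0))))
  -- The label sits in `num 4 0`, whose a priori bound is large. The truncated copy is visibly at
  -- most 1, so bit operations with it fit into `b` digits.
  | .num 5 _ => sub (lit 1) (sub (lit 1) (var (.num 4 0)))
  -- The difference below is 1 only for the first vector with scalar product 1, so that at most one
  -- vector is ever copied.
  | .bit 4 i (j + 1) l => or (var (.bit 4 i j l))
      (and (vec i j l) (sub (var (.bit 2 i j m)) (var (.bit 3 i j 0))))
  | .bit 5 i j l => flipDiag j l (xor (vec i j l) (and (var (.bit 4 i m l))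
      (if j = m then xor (var (.bit 2 i m m)) (var (.num 5 0)) else var (.bit 2 i j m))))
  | .bit 6 i _ _ => or (var (.bit 1 i 0 0))
      (sub (xor (var (.bit 2 i m m)) (var (.num 5 0))) (var (.bit 3 i m 0)))
  | _ => lit 0

/-- The definitions of the new values of the variables that are kept for the next round. -/
def nextState : Var → Expr
  | .num _ i => var (.num 1 i)
  | .bit 0 i j l => var (.bit 5 i j l)
  | .bit _ i j l => var (.bit 6 i j l)
  | _ => lit 0

/-- The variables `bit g i j l` in a given range. -/
def bits (G : Finset ℕ) (N m : ℕ) : Finset Var :=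
  (G ×ˢ Finset.range N ×ˢ Finset.range (m + 1) ×ˢ Finset.range (m + 1)).image
    fun p => .bit p.1 p.2.1 p.2.2.1 p.2.2.2

/-- The variables `num g i` in a given range. -/
def nums (G : Finset ℕ) (N : ℕ) : Finset Var :=
  (G ×ˢ Finset.range N).image fun p => .num p.1 p.2

/-- The nonzero entries of the table. -/
def tabs (m : ℕ) : Finset Var := (Finset.range (m + 1)).image fun d => .tab (2 * d)

section mem
variable {G : Finset ℕ} {N m g i j l e : ℕ}

@[simp] theorem bit_mem_bits :
    Var.bit g i j l ∈ bits G N m ↔ g ∈ G ∧ i < N ∧ j < m + 1 ∧ l < m + 1 := by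
  simp only [bits, Finset.mem_image, Finset.mem_product, Finset.mem_range, Prod.exists,
    Var.bit.injEq]
  constructor
  · rintro ⟨_, _, _, _, h, rfl, rfl, rfl, rfl⟩; exact h
  · intro h; exact ⟨g, i, j, l, h, rfl, rfl, rfl, rfl⟩

@[simp] theorem tab_notMem_bits : Var.tab e ∉ bits G N m := by simp [bits]

@[simp] theorem num_notMem_bits : Var.num g i ∉ bits G N m := by simp [bits]

@[simp] theorem num_mem_nums : Var.num g i ∈ nums G N ↔ g ∈ G ∧ i < N := by
  simp only [nums, Finset.mem_image, Finset.mem_product, Finset.mem_range, Prod.exists,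
    Var.num.injEq]
  constructor
  · rintro ⟨_, _, h, rfl, rfl⟩; exact h
  · intro h; exact ⟨g, i, h, rfl, rfl⟩

@[simp] theorem tab_notMem_nums : Var.tab e ∉ nums G N := by simp [nums]

@[simp] theorem bit_notMem_nums : Var.bit g i j l ∉ nums G N := by simp [nums]

@[simp] theorem tab_mem_tabs : Var.tab e ∈ tabs m ↔ ∃ d < m + 1, 2 * d = e := by
  simp [tabs]

@[simp] theorem num_notMem_tabs : Var.num g i ∉ tabs m := by simp [tabs]

@[simp] theorem bit_notMem_tabs : Var.bit g i j l ∉ tabs m := by simp [tabs]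

theorem card_bits_le (G : Finset ℕ) (N m : ℕ) : (bits G N m).card ≤ G.card * (N * (m + 1) ^ 2) := by
  refine Finset.card_image_le.trans_eq ?_
  simp [Finset.card_product, sq]

theorem card_nums_le (G : Finset ℕ) (N : ℕ) : (nums G N).card ≤ G.card * N := by
  refine Finset.card_image_le.trans_eq ?_
  simp [Finset.card_product]

theorem card_tabs_le (m : ℕ) : (tabs m).card ≤ m + 1 := by
  refine Finset.card_image_le.trans_eq ?_
  simp

end mem

/-! ### Bounds for values and names, and acyclicity of the definitions. -/

/-- Upper bounds for the variables. -/
def bound (N m : ℕ) : Var → ℕ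
  | .tab e => 2 ^ (m - e / 2)
  | .bit _ _ _ _ => 1
  | .num 2 i => i * 2 ^ m
  | .num 3 i => i * 2 ^ m
  | .num 4 _ => N * 2 ^ m + 1
  | .num 5 _ => 1
  | .num _ _ => m

theorem bound_tab_le (N m e : ℕ) : bound N m (.tab e) ≤ bound N m (.tab 0) := by
  simp only [bound]
  exact Nat.pow_le_pow_right (by norm_num) (by simp)

/-- Bounds for the number of digits of the numbers handled in an assignment to a variable. -/
def digits (b B : ℕ) : Var → ℕ
  | .bit _ _ _ _ => b
  | _ => B

/-- The number `b` is sufficiently large for the sizes of the names of the variables, and `B` is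
sufficiently large also for the sizes of their values. -/
structure Large (N m : ℕ) (σ : ℕ → ℕ → ℕ) (b B : ℕ) : Prop where
  eight_le : 8 ≤ b
  le : b ≤ B
  bit : ∀ g i j l, g < 10 → i ≤ N → j ≤ m → l ≤ m → (Var.bit g i j l).reg < 2 ^ b
  num : ∀ g i, g < 10 → i ≤ N → (Var.num g i).reg < 2 ^ b
  tab : ∀ e, e ≤ 2 * m + 1 → (Var.tab e).reg < 2 ^ b
  σ_lt : ∀ i l, i < N → l < m → σ i l < 2 ^ b
  value : (N + 1) * 2 ^ m + 1 < 2 ^ B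

section conditions
variable {N m : ℕ} {σ : ℕ → ℕ → ℕ} {b B : ℕ}

-- Negation, `xor` and `or` end in a subtraction from 1, so they are bounded by 1 whatever the
-- operands are. Conjunction has no such truncation.
@[simp] theorem ub_neg (β : Var → ℕ) (e : Expr) : (neg e).ub β = 1 := rfl
@[simp] theorem ub_xor (β : Var → ℕ) (e f : Expr) : (xor e f).ub β = 1 := rfl
@[simp] theorem ub_or (β : Var → ℕ) (e f : Expr) : (or e f).ub β = 1 := rfl
@[simp] theorem ub_and (β : Var → ℕ) (e f : Expr) : (and e f).ub β = e.ub β + f.ub β := rfl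

theorem ub_flipDiag_le (β : Var → ℕ) (j l : ℕ) {e : Expr} (he : e.ub β ≤ 1) :
    (flipDiag j l e).ub β ≤ 1 := by
  unfold flipDiag; split <;> simp [*]

theorem ub_vec_le (N m i j l : ℕ) : (vec i j l).ub (bound N m) ≤ 1 :=
  ub_flipDiag_le _ _ _ le_rfl

theorem fits_lit_one {β : Var → ℕ} {b : ℕ} (hb : 8 ≤ b) : (lit 1).Fits β b :=
  Nat.one_lt_two_pow (by omega)

theorem lt_two_pow_of_eight_le {b : ℕ} (hb : 8 ≤ b) : 250 < 2 ^ b := by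
  have : 2 ^ 8 ≤ 2 ^ b := Nat.pow_le_pow_right (by norm_num) hb
  omega

theorem fits_neg {β : Var → ℕ} {b : ℕ} (hb : 8 ≤ b) {e : Expr} (h : e.Fits β b) :
    (neg e).Fits β b := ⟨fits_lit_one hb, h⟩

theorem fits_xor {β : Var → ℕ} {b : ℕ} (hb : 8 ≤ b) {e f : Expr} (he : e.Fits β b)
    (hf : f.Fits β b) (hu : e.ub β + f.ub β < 2 ^ b) : (xor e f).Fits β b :=
  ⟨fits_lit_one hb, fits_lit_one hb, ⟨he, hf⟩, ⟨hf, he⟩, hu⟩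

theorem fits_or {β : Var → ℕ} {b : ℕ} (hb : 8 ≤ b) {e f : Expr} (he : e.Fits β b)
    (hf : f.Fits β b) (hu : e.ub β + f.ub β < 2 ^ b) : (or e f).Fits β b :=
  ⟨fits_lit_one hb, fits_lit_one hb, he, hf, hu⟩

theorem fits_and {β : Var → ℕ} {b : ℕ} (hb : 8 ≤ b) {e f : Expr} (he : e.Fits β b)
    (hf : f.Fits β b) (hu : e.ub β + f.ub β < 2 ^ b) : (and e f).Fits β b :=
  ⟨⟨he, hf, hu⟩, fits_lit_one hb⟩

theorem fits_flipDiag {β : Var → ℕ} {b : ℕ} (hb : 8 ≤ b) (j l : ℕ) {e : Expr} (he : e.Fits β b) :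
    (flipDiag j l e).Fits β b := by
  unfold flipDiag; split
  · exact fits_neg hb he
  · exact he

theorem fits_bit (h : Large N m σ b B) {g i j l : ℕ} (hg : g < 10) (hi : i ≤ N) (hj : j ≤ m)
    (hl : l ≤ m) : (var (.bit g i j l)).Fits (bound N m) b :=
  ⟨h.bit g i j l hg hi hj hl, by
    have := lt_two_pow_of_eight_le h.eight_le
    simp only [bound]; omega⟩

theorem fits_vec (h : Large N m σ b B) {i j l : ℕ} (hi : i ≤ N) (hj : j ≤ m)
    (hl : l ≤ m) : (vec i j l).Fits (bound N m) b :=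
  fits_flipDiag h.eight_le _ _ (fits_bit h (by norm_num) hi hj hl)

theorem Large.mono (h : Large N m σ b B) : Large N m σ B B where
  eight_le := h.eight_le.trans h.le
  le := le_rfl
  bit g i j l h₁ h₂ h₃ h₄ :=
    (h.bit g i j l h₁ h₂ h₃ h₄).trans_le (Nat.pow_le_pow_right (by norm_num) h.le)
  num g i h₁ h₂ := (h.num g i h₁ h₂).trans_le (Nat.pow_le_pow_right (by norm_num) h.le)
  tab e h₁ := (h.tab e h₁).trans_le (Nat.pow_le_pow_right (by norm_num) h.le)
  σ_lt i l h₁ h₂ := (h.σ_lt i l h₁ h₂).trans_le (Nat.pow_le_pow_right (by norm_num) h.le)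
  value := h.value

theorem bound_num_le (N m g i : ℕ) (hi : i ≤ N) : bound N m (.num g i) ≤ (N + 1) * 2 ^ m + 1 := by
  have h₁ : i * 2 ^ m ≤ N * 2 ^ m := Nat.mul_le_mul_right _ hi
  have h₂ : m < 2 ^ m := Nat.lt_two_pow_self
  have h₃ : (N + 1) * 2 ^ m = N * 2 ^ m + 2 ^ m := by ring
  match g with
  | 0 | 1 | 2 | 3 | 4 | 5 | _ + 6 => simp only [bound]; omega

theorem fits_num (h : Large N m σ b B) {g i : ℕ} (hg : g < 10) (hi : i ≤ N) :
    (var (.num g i)).Fits (bound N m) B :=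
  ⟨h.mono.num g i hg hi, (bound_num_le N m g i hi).trans_lt h.value⟩

theorem depth_flipDiag_le (j l : ℕ) (e : Expr) : (flipDiag j l e).depth ≤ e.depth + 1 := by
  unfold flipDiag; split <;> simp [neg, depth]

theorem count_flipDiag_le (j l : ℕ) (e : Expr) : (flipDiag j l e).count ≤ e.count + 2 := by
  unfold flipDiag; split <;> simp [neg, count]; omega

theorem reads_flipDiag {β : Var → ℕ} {j l : ℕ} {e : Expr} {w : Var}
    (h : (flipDiag j l e).Reads β w) : e.Reads β w := by
  unfold flipDiag at h; split at h
  · simpa [neg, Reads] using h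
  · exact h

theorem reads_vec {β : Var → ℕ} {i j l : ℕ} {w : Var} (h : (vec i j l).Reads β w) :
    w = .bit 0 i j l := reads_flipDiag h

@[simp] theorem reads_neg {β : Var → ℕ} {e : Expr} {w : Var} :
    (neg e).Reads β w ↔ e.Reads β w := by simp [neg, Reads]

@[simp] theorem reads_xor {β : Var → ℕ} {e f : Expr} {w : Var} :
    (Expr.xor e f).Reads β w ↔ e.Reads β w ∨ f.Reads β w := by
  simp [Expr.xor, Reads, or_comm]

@[simp] theorem reads_and {β : Var → ℕ} {e f : Expr} {w : Var} :
    (Expr.and e f).Reads β w ↔ e.Reads β w ∨ f.Reads β w := by simp [Expr.and, Reads]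

@[simp] theorem reads_or {β : Var → ℕ} {e f : Expr} {w : Var} :
    (Expr.or e f).Reads β w ↔ e.Reads β w ∨ f.Reads β w := by simp [Expr.or, Reads]

theorem reads_load_vote {N m i : ℕ} {q : Expr} {w : Var}
    (h : (load (vote i m q)).Reads (bound N m) w) :
    w = .num 0 i ∨ w = .bit 1 i 0 0 ∨ q.Reads (bound N m) w ∨ w = .bit 3 i m 0 ∨
      ∃ r ≤ 2 * m + 1, w = .tab r := by
  simp only [vote, Reads, reads_or, ub, ub_or, bound] at h
  grind

/-- The variables computed before the prediction. -/
def varsBefore (N m : ℕ) : Finset Var :=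
  bits {2, 3} N m ∪ (tabs m ∪ nums {2, 3} (N + 1) ∪ {.num 4 0})

/-- The variables computed after the label has been revealed. -/
def varsAfter (N m : ℕ) : Finset Var := bits {4, 5, 6} N m ∪ (nums {1} N ∪ {.num 5 0})

/-- The variables that are kept for the next round. -/
def varsNext (N m : ℕ) : Finset Var := bits {0, 1} N m ∪ nums {0} N

@[simp] theorem tab_mem_varsBefore {N m e : ℕ} :
    Var.tab e ∈ varsBefore N m ↔ ∃ d < m + 1, 2 * d = e := by simp [varsBefore]

@[simp] theorem bit_mem_varsBefore {N m g i j l : ℕ} : Var.bit g i j l ∈ varsBefore N m ↔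
    (g = 2 ∨ g = 3) ∧ i < N ∧ j < m + 1 ∧ l < m + 1 := by simp [varsBefore]

@[simp] theorem num_mem_varsBefore {N m g i : ℕ} : Var.num g i ∈ varsBefore N m ↔
    (g = 2 ∨ g = 3) ∧ i < N + 1 ∨ g = 4 ∧ i = 0 := by
  simp [varsBefore, Order.lt_add_one_iff, or_comm]

@[simp] theorem tab_notMem_varsAfter {N m e : ℕ} : Var.tab e ∉ varsAfter N m := by
  simp [varsAfter]

@[simp] theorem bit_mem_varsAfter {N m g i j l : ℕ} : Var.bit g i j l ∈ varsAfter N m ↔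
    (g = 4 ∨ g = 5 ∨ g = 6) ∧ i < N ∧ j < m + 1 ∧ l < m + 1 := by simp [varsAfter]

@[simp] theorem num_mem_varsAfter {N m g i : ℕ} : Var.num g i ∈ varsAfter N m ↔
    g = 1 ∧ i < N ∨ g = 5 ∧ i = 0 := by simp [varsAfter, or_comm]

@[simp] theorem tab_notMem_varsNext {N m e : ℕ} : Var.tab e ∉ varsNext N m := by
  simp [varsNext]

@[simp] theorem bit_mem_varsNext {N m g i j l : ℕ} : Var.bit g i j l ∈ varsNext N m ↔
    (g = 0 ∨ g = 1) ∧ i < N ∧ j < m + 1 ∧ l < m + 1 := by simp [varsNext]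

@[simp] theorem num_mem_varsNext {N m g i : ℕ} : Var.num g i ∈ varsNext N m ↔
    g = 0 ∧ i < N := by simp [varsNext]

/-- The rank follows the flow of data: the table from its last entry downwards, scalar products by
the length of the partial sum, then their disjunctions, the sums of votes, and the comparison. -/
theorem beforeLabel_acyclic (N m : ℕ) (σ : ℕ → ℕ → ℕ) : ∃ rank : Var → ℕ,
    ∀ v ∈ varsBefore N m, ∀ w ∈ varsBefore N m,
      (beforeLabel N m σ v).Reads (bound N m) w → rank w < rank v := by
  refine ⟨fun v => match v with
    | .tab e => 2 * m + 2 - e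
    | .bit 2 _ _ l => l
    | .bit _ _ j _ => m + 1 + j
    | .num 4 _ => 2 * m + N + 10
    | .num _ i => 2 * m + 5 + i, fun v hv w hw h => ?_⟩
  unfold beforeLabel at h
  split at h
  · simp only [tab_mem_varsBefore] at hv
    split_ifs at h
    · exact h.elim
    · simp only [Reads, or_self] at h
      subst h
      simp only
      omega
  · simp only [reads_xor, reads_and, Reads, false_or] at h
    rcases h with rfl | h
    · simp
    · rw [reads_vec h] at hw
      simp at hw
  · simp only [bit_mem_varsBefore] at hv
    simp only [reads_or, Reads] at h
    rcases h with rfl | rfl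
    · simp
    · simp only; omega
  · rcases h with rfl | h
    · simp
    · rcases reads_load_vote h with rfl | rfl | h | rfl | ⟨r, hr, rfl⟩
      · simp at hw
      · simp at hw
      · obtain rfl := h; simp only; omega
      · simp only; omega
      · simp only; omega
  · rcases h with rfl | h
    · simp
    · rcases reads_load_vote h with rfl | rfl | h | rfl | ⟨r, hr, rfl⟩
      · simp at hw
      · simp at hw
      · obtain rfl := reads_neg.1 h; simp only; omega
      · simp only; omega
      · simp only; omega
  · rcases h with rfl | rfl <;> simp only <;> omega
  · exact h.elim

theorem afterLabel_acyclic (N m : ℕ) : ∃ rank : Var → ℕ,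
    ∀ v ∈ varsAfter N m, ∀ w ∈ varsAfter N m,
      (afterLabel m v).Reads (bound N m) w → rank w < rank v := by
  refine ⟨fun v => match v with
    | .tab _ => 0
    | .bit 4 _ j _ => j
    | .bit _ _ _ _ => m + 1
    | .num 5 _ => 0
    | .num _ i => 1, fun v hv w hw h => ?_⟩
  unfold afterLabel at h
  split at h
  · simp only [Reads, false_or] at h
    rcases h with rfl | rfl <;> simp at hw
  · simp only [Reads, false_or] at h
    subst h; simp at hw
  · simp only [reads_or, reads_and, Reads] at h
    rcases h with rfl | h | rfl | rfl
    · simp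
    · rw [reads_vec h] at hw; simp at hw
    · simp at hw
    · simp at hw
  · replace h := reads_flipDiag h
    simp only [reads_xor, reads_and] at h
    rcases h with h | rfl | h
    · rw [reads_vec h] at hw; simp at hw
    · simp
    · split_ifs at h
      · simp only [reads_xor, Reads] at h
        rcases h with rfl | rfl
        · simp at hw
        · simp
      · obtain rfl := h; simp at hw
  · simp only [reads_or, reads_xor, Reads] at h
    rcases h with rfl | (rfl | rfl) | rfl
    · simp at hw
    · simp at hw
    · simp
    · simp at hw
  · exact h.elim

/-- The new state was computed into separate variables, so copying it back is free of dependencies;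
this is how all vectors of a space are updated simultaneously. -/
theorem nextState_acyclic (N m : ℕ) : ∀ v ∈ varsNext N m, ∀ w ∈ varsNext N m,
    ¬(nextState v).Reads (bound N m) w := by
  intro v hv w hw h
  unfold nextState at h
  split at h
  · obtain rfl := h; simp at hw
  · obtain rfl := h; simp at hw
  · obtain rfl := h; simp at hw
  · exact h

theorem ub_beforeLabel_le (N m : ℕ) (σ : ℕ → ℕ → ℕ) : ∀ v ∈ varsBefore N m,
    (beforeLabel N m σ v).ub (bound N m) ≤ bound N m v := by
  intro v hv
  unfold beforeLabel
  split
  · simp only [tab_mem_varsBefore] at hv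
    obtain ⟨d, hd, rfl⟩ := hv
    split_ifs with he
    · simp [ub, bound, Nat.one_le_two_pow]
    · have : m - d = m - (2 * d + 2) / 2 + 1 := by omega
      simp only [ub, bound, Nat.mul_div_cancel_left d two_pos, this, pow_succ]
      omega
  all_goals try simp only [ub_xor, ub_or, bound, le_refl]
  · simp only [ub, bound, Nat.zero_div, Nat.sub_zero]; linarith
  · simp only [ub, bound, Nat.zero_div, Nat.sub_zero]; linarith
  · simp only [ub, bound]; omega
  · simp [ub]

theorem ub_afterLabel_le (N m : ℕ) : ∀ v ∈ varsAfter N m,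
    (afterLabel m v).ub (bound N m) ≤ bound N m v := by
  intro v hv
  unfold afterLabel
  split
  all_goals try simp only [ub_or, bound, le_refl, ub]
  · exact ub_flipDiag_le _ _ _ le_rfl
  · simp

theorem ub_nextState_le (N m : ℕ) : ∀ v ∈ varsNext N m,
    (nextState v).ub (bound N m) ≤ bound N m v := by
  intro v hv
  unfold nextState
  split
  · simp only [num_mem_varsNext] at hv
    simp [ub, bound, hv.1]
  all_goals simp [ub, bound]

theorem fits_vote (h : Large N m σ b B) {i : ℕ} (hi : i < N) {q : Expr} (hq : q.Fits (bound N m) B)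
    (hq' : q.ub (bound N m) = 1) : (load (vote i m q)).Fits (bound N m) B := by
  have h0 := lt_two_pow_of_eight_le h.mono.eight_le
  have h1 := fits_num h (g := 0) (by norm_num) hi.le
  have ht := h.mono.tab (2 * m + 1) le_rfl
  simp only [Var.reg] at ht
  refine ⟨⟨⟨h1, h1, ?_⟩, fits_or h.mono.eight_le ⟨fits_bit h.mono (by norm_num) hi.le
    (Nat.zero_le _) (Nat.zero_le _), hq, ?_⟩ (fits_bit h.mono (by norm_num) hi.le
    le_rfl (Nat.zero_le _)) ?_, ?_⟩, ?_, ?_⟩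
  all_goals simp only [ub, ub_or, hq', bound, vote]
  any_goals omega
  refine lt_of_le_of_lt ?_ h.value
  simp only [Nat.zero_div, Nat.sub_zero, Nat.add_mul]
  omega

theorem fits_lit_zero {β : Var → ℕ} {b : ℕ} : (lit 0).Fits β b := Nat.two_pow_pos b

theorem fits_beforeLabel (h : Large N m σ b B) : ∀ v ∈ varsBefore N m,
    (beforeLabel N m σ v).Fits (bound N m) (digits b B v) := by
  intro v hv
  have h0 := lt_two_pow_of_eight_le h.eight_le
  have h0' := lt_two_pow_of_eight_le h.mono.eight_le
  have hval := h.value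
  have hexp : (N + 1) * 2 ^ m = N * 2 ^ m + 2 ^ m := by ring
  unfold beforeLabel
  split
  · simp only [tab_mem_varsBefore] at hv
    obtain ⟨d, hd, rfl⟩ := hv
    split_ifs
    · exact fits_lit_one h.mono.eight_le
    · have h3 : m - d = m - (2 * d + 2) / 2 + 1 := by omega
      have h4 : 2 ^ (m - (2 * d + 2) / 2 + 1) ≤ 2 ^ m :=
        Nat.pow_le_pow_right (by norm_num) (by omega)
      rw [pow_succ] at h4
      have h5 : (var (.tab (2 * d + 2))).Fits (bound N m) B :=
        ⟨h.mono.tab _ (by omega), by simp only [bound]; omega⟩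
      exact ⟨h5, h5, by simp only [ub, bound, digits]; omega⟩
  · rename_i i j l
    simp only [bit_mem_varsBefore] at hv
    have := ub_vec_le N m i j l
    refine fits_xor h.eight_le (fits_bit h (by norm_num) (by omega) (by omega) (by omega))
      (fits_and h.eight_le (h.σ_lt _ _ (by omega) (by omega))
        (fits_vec h (by omega) (by omega) (by omega)) ?_) ?_
    all_goals
      simp only [ub, ub_and, bound]
      omega
  · simp only [bit_mem_varsBefore] at hv
    refine fits_or h.eight_le (fits_bit h (by norm_num) (by omega) (by omega) (by omega))
      (fits_bit h (by norm_num) (by omega) (by omega) (by omega)) ?_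
    simp only [ub, bound]; omega
  · rename_i i
    simp only [num_mem_varsBefore] at hv
    refine ⟨fits_num h (by norm_num) (by omega), fits_vote h (by omega)
      (fits_bit h.mono (by norm_num) (by omega) (by omega) (by omega)) rfl, ?_⟩
    have : i * 2 ^ m ≤ N * 2 ^ m := Nat.mul_le_mul_right _ (by omega)
    simp only [ub, bound, Nat.zero_div, Nat.sub_zero, digits]
    omega
  · rename_i i
    simp only [num_mem_varsBefore] at hv
    refine ⟨fits_num h (by norm_num) (by omega), fits_vote h (by omega)
      (fits_neg h.mono.eight_le (fits_bit h.mono (by norm_num) (by omega) (by omega) (by omega)))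
      rfl, ?_⟩
    have : i * 2 ^ m ≤ N * 2 ^ m := Nat.mul_le_mul_right _ (by omega)
    simp only [ub, bound, Nat.zero_div, Nat.sub_zero, digits]
    omega
  · exact ⟨fits_num h (by norm_num) le_rfl, fits_num h (by norm_num) le_rfl⟩
  · exact fits_lit_zero

theorem fits_afterLabel (h : Large N m σ b B) : ∀ v ∈ varsAfter N m,
    (afterLabel m v).Fits (bound N m) (digits b B v) := by
  intro v hv
  have h0 := lt_two_pow_of_eight_le h.eight_le
  have h0' := lt_two_pow_of_eight_le h.mono.eight_le
  have h5 : (var (.num 5 0)).Fits (bound N m) b :=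
    ⟨h.num 5 0 (by norm_num) (by omega), by simp only [bound]; omega⟩
  have hval := h.value
  have hm := h.mono.tab (2 * m + 1) le_rfl
  simp only [Var.reg] at hm
  unfold afterLabel
  split
  · simp only [num_mem_varsAfter] at hv
    refine ⟨(by omega : m < 2 ^ B), (by omega : m < 2 ^ B), fits_num h (by norm_num) (by omega),
      fits_bit h.mono (by norm_num) (by omega) (by omega) (by omega), ?_⟩
    simp only [ub, bound, digits]; omega
  · exact ⟨fits_lit_one h.mono.eight_le, fits_lit_one h.mono.eight_le,
      fits_num h (by norm_num) (by omega)⟩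
  · rename_i i j l
    simp only [bit_mem_varsAfter] at hv
    have := ub_vec_le N m i j l
    refine fits_or h.eight_le (fits_bit h (by norm_num) (by omega) (by omega) (by omega))
      (fits_and h.eight_le (fits_vec h (by omega) (by omega) (by omega))
        ⟨fits_bit h (by norm_num) (by omega) (by omega) (by omega),
          fits_bit h (by norm_num) (by omega) (by omega) (by omega)⟩ ?_) ?_
    all_goals
      simp only [ub, ub_and, bound]
      omega
  · rename_i i j l
    simp only [bit_mem_varsAfter] at hv
    have := ub_vec_le N m i j l
    have hs : (if j = m then Expr.xor (var (.bit 2 i m m)) (var (.num 5 0))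
        else var (.bit 2 i j m)).Fits (bound N m) b ∧
        (if j = m then Expr.xor (var (.bit 2 i m m)) (var (.num 5 0))
        else var (.bit 2 i j m)).ub (bound N m) = 1 := by
      split_ifs
      · exact ⟨fits_xor h.eight_le (fits_bit h (by norm_num) (by omega) (by omega) (by omega))
          h5 (by simp only [ub, bound]; omega), rfl⟩
      · exact ⟨fits_bit h (by norm_num) (by omega) (by omega) (by omega), rfl⟩
    refine fits_flipDiag h.eight_le _ _ (fits_xor h.eight_le
      (fits_vec h (by omega) (by omega) (by omega))
      (fits_and h.eight_le (fits_bit h (by norm_num) (by omega) (by omega) (by omega)) hs.1 ?_) ?_)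
    all_goals
      simp only [ub_and, hs.2]
      simp only [ub, bound]
      omega
  · simp only [bit_mem_varsAfter] at hv
    refine fits_or h.eight_le (fits_bit h (by norm_num) (by omega) (by omega) (by omega))
      ⟨fits_xor h.eight_le (fits_bit h (by norm_num) (by omega) (by omega) (by omega)) h5 ?_,
        fits_bit h (by norm_num) (by omega) (by omega) (by omega)⟩ ?_
    all_goals
      simp only [ub, ub_xor, bound]
      omega
  · exact fits_lit_zero

theorem fits_nextState (h : Large N m σ b B) : ∀ v ∈ varsNext N m,
    (nextState v).Fits (bound N m) (digits b B v) := by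
  intro v hv
  unfold nextState
  split
  · simp only [num_mem_varsNext] at hv
    exact fits_num h (by norm_num) (by omega)
  · simp only [bit_mem_varsNext] at hv
    exact fits_bit h (by norm_num) (by omega) (by omega) (by omega)
  · simp only [bit_mem_varsNext] at hv
    exact fits_bit h (by norm_num) (by omega) (by omega) (by omega)
  · exact fits_lit_zero

theorem reg_lt (h : Large N m σ b B) : ∀ v ∈ varsBefore N m ∪ varsAfter N m ∪ varsNext N m,
    v.reg < 2 ^ digits b B v := by
  intro v hv
  match v with
  | .tab e =>
    simp only [Finset.mem_union, tab_mem_varsBefore, tab_notMem_varsAfter, tab_notMem_varsNext,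
      or_false] at hv
    exact h.mono.tab e (by omega)
  | .bit g i j l =>
    simp only [Finset.mem_union, bit_mem_varsBefore, bit_mem_varsAfter, bit_mem_varsNext] at hv
    exact h.bit g i j l (by omega) (by omega) (by omega) (by omega)
  | .num g i =>
    simp only [Finset.mem_union, num_mem_varsBefore, num_mem_varsAfter, num_mem_varsNext] at hv
    exact h.mono.num g i (by omega) (by omega)

theorem eight_le_digits (h : Large N m σ b B) (v : Var) : 8 ≤ digits b B v := by
  unfold digits; split
  · exact h.eight_le
  · exact h.mono.eight_le

theorem depth_vec_le (i j l : ℕ) : (vec i j l).depth ≤ 1 := depth_flipDiag_le _ _ _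

theorem count_vec_le (i j l : ℕ) : (vec i j l).count ≤ 3 := count_flipDiag_le _ _ _

theorem beforeLabel_small (N m : ℕ) (σ : ℕ → ℕ → ℕ) (v : Var) :
    (beforeLabel N m σ v).depth ≤ 60 ∧ (beforeLabel N m σ v).count + 1 ≤ 100 := by
  unfold beforeLabel
  split
  · split_ifs <;> simp [depth, count]
  · rename_i i j l
    have := depth_vec_le i j l
    have := count_vec_le i j l
    simp only [Expr.xor, Expr.and, depth, count]; omega
  all_goals simp [Expr.or, neg, vote, depth, count]

theorem afterLabel_small (m : ℕ) (v : Var) :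
    (afterLabel m v).depth ≤ 60 ∧ (afterLabel m v).count + 1 ≤ 100 := by
  unfold afterLabel
  split
  · simp [depth, count]
  · simp [depth, count]
  · rename_i i j l
    have := depth_vec_le i j l
    have := count_vec_le i j l
    simp only [Expr.or, Expr.and, depth, count]; omega
  · rename_i i j l
    have := depth_vec_le i j l
    have := count_vec_le i j l
    have hd := depth_flipDiag_le j l (Expr.xor (vec i j l) (Expr.and (var (.bit 4 i m l))
      (if j = m then Expr.xor (var (.bit 2 i m m)) (var (.num 5 0)) else var (.bit 2 i j m))))
    have hc := count_flipDiag_le j l (Expr.xor (vec i j l) (Expr.and (var (.bit 4 i m l))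
      (if j = m then Expr.xor (var (.bit 2 i m m)) (var (.num 5 0)) else var (.bit 2 i j m))))
    refine ⟨hd.trans ?_, (Nat.add_le_add_right hc 1).trans ?_⟩
    all_goals
      split_ifs <;> simp only [Expr.xor, Expr.and, depth, count] <;> omega
  · simp [Expr.or, Expr.xor, depth, count]
  · simp [depth, count]

theorem nextState_small (v : Var) :
    (nextState v).depth ≤ 60 ∧ (nextState v).count + 1 ≤ 100 := by
  unfold nextState; split <;> simp [depth, count]

end conditions

end ParityRAM

namespace ParityRAM
open ParityRAM.Expr

/-! ### Cost of a round and assembly of the program. -/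

/-- A bound for the cost of a round of the learning program. -/
def roundCost (N m b B : ℕ) : ℕ := 600 * (7 * (N * (m + 1) ^ 2) * b + (m + 4 * N + 6) * B)

/-- An assignment has at most 100 instructions of cost at most 6 times the number of digits. Only
the few numbers are charged the long length `B`, while the roughly `N * (m + 1) ^ 2` bits are
charged `b`; charging `B` everywhere would cost a further factor of about `m`. -/
theorem sum_digits_le {X S : Finset Var} {df : Var → Expr} {b B s t : ℕ} {G : Finset ℕ} {N m : ℕ}
    (hX : X = bits G N m ∪ S) (hb : b ≤ B) (hdf : ∀ v, (df v).count + 1 ≤ 100)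
    (hG : G.card ≤ s) (hS : S.card ≤ t) :
    ∑ v ∈ X, 6 * digits b B v * ((df v).count + 1) ≤
      600 * (s * (N * (m + 1) ^ 2) * b + t * B) := by
  have h₁ : ∀ v ∈ bits G N m, 6 * digits b B v * ((df v).count + 1) ≤ 600 * b := by
    intro v hv
    match v with
    | .bit g i j l =>
      calc 6 * b * _ ≤ 6 * b * 100 := Nat.mul_le_mul_left _ (hdf _)
        _ = 600 * b := by ring
    | .tab e => simp at hv
    | .num g i => simp at hv
  have h₂ : ∀ v ∈ S, 6 * digits b B v * ((df v).count + 1) ≤ 600 * B := by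
    intro v _
    have : digits b B v ≤ B := by unfold digits; split <;> omega
    calc 6 * digits b B v * _ ≤ 6 * B * 100 := Nat.mul_le_mul (by omega) (hdf _)
      _ = 600 * B := by ring
  have h₃ : (bits G N m).card ≤ s * (N * (m + 1) ^ 2) :=
    (card_bits_le G N m).trans (Nat.mul_le_mul_right _ hG)
  calc ∑ v ∈ X, 6 * digits b B v * ((df v).count + 1)
      ≤ ∑ v ∈ bits G N m, 6 * digits b B v * ((df v).count + 1)
        + ∑ v ∈ S, 6 * digits b B v * ((df v).count + 1) := by
        rw [hX, ← Finset.sum_union_inter]; exact Nat.le_add_right _ _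
    _ ≤ (bits G N m).card * (600 * b) + S.card * (600 * B) := by
        gcongr
        · simpa using Finset.sum_le_card_nsmul _ _ _ h₁
        · simpa using Finset.sum_le_card_nsmul _ _ _ h₂
    _ ≤ s * (N * (m + 1) ^ 2) * (600 * b) + t * (600 * B) := by gcongr
    _ = _ := by ring

theorem getElem?_of_eq_append {P X Y : Program} {I : Instr} {r : ℕ} (h : P = X ++ I :: Y)
    (hr : r = X.length) : P[r]? = some I := by
  subst h hr; simp

/-- The only jump is the last instruction. The first round starts at 0 and every later one at this
jump, which costs 4. All other instructions are executed exactly once per round, whence the bound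
for the size. -/
theorem round_of_sim {p q : Program} {n : ℕ} {a : Fin n → ZMod 2} {y : ZMod 2} {M M₁ M' : Var → ℕ}
    {B B' b r : ℕ} (v : Var) (hp : Sim a p M B M₁) (hq : Sim a q (Function.update M₁ v y.val) B' M')
    (hb : 1 ≤ b) (hv : v.reg < 2 ^ b) (hMv : M₁ v < 2 ^ b) {R : ℕ → ℕ} (h0 : R 0 = 0)
    (hR : ∀ v : Var, R v.reg = M v) (hr : r = 0 ∨ r = p.length + q.length + 2) :
    ∃ T R', Round (p ++ ([.predict v.reg] ++ (q ++ [.next, .jumpZero 0 0]))) a y ⟨r, R⟩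
        (if M₁ v = 0 then 0 else 1) T ⟨p.length + q.length + 2, R'⟩ ∧
      T ≤ B + B' + 2 * b + 6 ∧
      Program.size (p ++ ([.predict v.reg] ++ (q ++ [.next, .jumpZero 0 0]))) ≤ T + 4 ∧
      R' 0 = 0 ∧ ∀ v : Var, R' v.reg = M' v := by
  obtain ⟨T₁, R₁, r₁, hT₁, hs₁, h0₁, hR₁⟩ := hp R h0 hR
  obtain ⟨T₂, R₂, r₂, hT₂, hs₂, h0₂, hR₂⟩ := hq (Function.update R₁ v.reg y.val)
    (by rw [Function.update_of_ne v.reg_ne_zero.symm, h0₁]) (fun w => by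
      rcases eq_or_ne w v with rfl | hw
      · simp
      · rw [Function.update_of_ne hw, Function.update_of_ne (Var.reg_injective.ne hw), hR₁])
  set P : Program := p ++ ([.predict v.reg] ++ (q ++ [.next, .jumpZero 0 0])) with hP
  have hstart : ∃ T₀ ≤ 4, Reaches P a ⟨r, R⟩ T₀ ⟨0, R⟩ := by
    rcases hr with rfl | rfl
    · exact ⟨0, by norm_num, Reaches.refl _⟩
    · refine ⟨_, ?_, Reaches.head (I := .jumpZero 0 0) ?_ ?_ (Reaches.refl _)⟩
      · simp [Instr.cost, Instr.size, len, h0]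
      · exact getElem?_of_eq_append (X := p ++ [.predict v.reg] ++ q ++ [.next]) (Y := [])
          (by simp [hP]) (by simp; omega)
      · simp [Instr.step, h0]
  obtain ⟨T₀, hT₀, r₀⟩ := hstart
  have e₁ : Reaches P a ⟨0, R⟩ T₁ ⟨p.length, R₁⟩ := by
    have := r₁ [] ([.predict v.reg] ++ (q ++ [.next, .jumpZero 0 0]))
    simpa [hP] using this
  have e₂ : Reaches P a ⟨p.length + 1, Function.update R₁ v.reg y.val⟩ T₂
      ⟨p.length + 1 + q.length, R₂⟩ := by
    have := r₂ (p ++ [.predict v.reg]) [.next, .jumpZero 0 0]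
    simpa [hP] using this
  have hlen₁ := len_le_of_lt hb hv
  have hlen₂ := len_le_of_lt hb hMv
  refine ⟨_, R₂, ⟨⟨p.length, R₁⟩, ⟨p.length + 1 + q.length, R₂⟩, T₀ + T₁, T₂, v.reg,
    r₀.trans e₁, ?_, ?_, e₂, ?_, ?_, rfl⟩, ?_, ?_, h0₂, hR₂⟩
  · simp [hP]
  · simp [hR₁]
  · exact getElem?_of_eq_append (X := p ++ [.predict v.reg] ++ q) (Y := [.jumpZero 0 0])
      (by simp [hP]) (by simp; omega)
  · simp only [Config.mk.injEq, and_true]; omega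
  · simp only [Instr.cost, Instr.size, hR₁]; omega
  · simp only [hP, Program.size_append]
    simp only [Program.size, List.map, List.sum_cons, List.sum_nil, Instr.size, Instr.cost, len,
      Nat.log_zero_right] at *
    omega

/-- The variables have the values `M` at the beginning of a round, `M₁` at the time of the prediction,
`M₂` before the variables that are kept for the next round are changed, and `M'` at the end. -/
structure IsRound {n : ℕ} (N m : ℕ) (σ : ℕ → ℕ → ℕ) (a : Fin n → ZMod 2) (y : ZMod 2)
    (M M₁ M₂ M' : Var → ℕ) : Prop where
  le : ∀ v, M v ≤ bound N m v
  le' : ∀ v, M' v ≤ bound N m v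
  le₁ : ∀ v, M₁ v ≤ bound N m v
  le₂ : ∀ v, M₂ v ≤ bound N m v
  before : ∀ v ∈ varsBefore N m, M₁ v = (beforeLabel N m σ v).eval a M₁
  before_ne : ∀ v ∉ varsBefore N m, M₁ v = M v
  after : ∀ v ∈ varsAfter N m, M₂ v = (afterLabel m v).eval a M₂
  after_ne : ∀ v ∉ varsAfter N m, v ≠ .num 4 0 → M₂ v = M₁ v
  label : M₂ (.num 4 0) = y.val
  next : ∀ v ∈ varsNext N m, M' v = (nextState v).eval a M'
  next_ne : ∀ v ∉ varsNext N m, M' v = M₂ v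

/-- The learning program exists; in every round, its variables satisfy their defining equations. -/
theorem exists_program {N m : ℕ} {σ : ℕ → ℕ → ℕ} {b B : ℕ} (h : Large N m σ b B) :
    ∃ (P : Program) (L : ℕ), P.size ≤ roundCost N m b B ∧
      ∀ {n : ℕ} (a : Fin n → ZMod 2) (y : ZMod 2) (c : Config),
        (c.pc = 0 ∨ c.pc = L) → c.reg 0 = 0 → (∀ v : Var, c.reg v.reg ≤ bound N m v) →
        ∃ (M₁ M₂ : Var → ℕ) (T : ℕ) (c' : Config),
          Round P a y c (if M₁ (.num 4 0) = 0 then 0 else 1) T c' ∧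
          T ≤ roundCost N m b B ∧ c'.pc = L ∧ c'.reg 0 = 0 ∧
          IsRound N m σ a y (fun v => c.reg v.reg) M₁ M₂ (fun v => c'.reg v.reg) := by
  obtain ⟨rank, hrank⟩ := beforeLabel_acyclic N m σ
  obtain ⟨p, hp⟩ := exists_schedule (varsBefore N m) (beforeLabel N m σ) rank (digits b B)
    (bound_tab_le N m) hrank (ub_beforeLabel_le N m σ) (fun v _ => eight_le_digits h v)
    (fits_beforeLabel h) (fun v _ => (beforeLabel_small N m σ v).1)
    (fun v hv => reg_lt h v (by simp [hv]))
  obtain ⟨rank', hrank'⟩ := afterLabel_acyclic N m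
  obtain ⟨q, hq⟩ := exists_schedule (varsAfter N m) (afterLabel m) rank' (digits b B)
    (bound_tab_le N m) hrank' (ub_afterLabel_le N m) (fun v _ => eight_le_digits h v)
    (fits_afterLabel h) (fun v _ => (afterLabel_small m v).1)
    (fun v hv => reg_lt h v (by simp [hv]))
  obtain ⟨q', hq'⟩ := exists_schedule (varsNext N m) nextState (fun _ => 0) (digits b B)
    (bound_tab_le N m) (fun v hv w hw hr => (nextState_acyclic N m v hv w hw hr).elim)
    (ub_nextState_le N m) (fun v _ => eight_le_digits h v)
    (fits_nextState h) (fun v _ => (nextState_small v).1)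
    (fun v hv => reg_lt h v (by simp [hv]))
  have hc₁ := sum_digits_le (X := varsBefore N m) (df := beforeLabel N m σ) (s := 2)
    (t := m + 2 * N + 4) rfl h.le (fun v => (beforeLabel_small N m σ v).2) (by simp) (by
      refine (Finset.card_union_le _ _).trans ?_
      have h₁ := Finset.card_union_le (tabs m) (nums {2, 3} (N + 1))
      have h₂ := card_tabs_le m
      have h₃ := card_nums_le {2, 3} (N + 1)
      have h₄ : ({2, 3} : Finset ℕ).card = 2 := by simp
      rw [h₄] at h₃
      simp only [Finset.card_singleton]; omega)
  have hc₂ := sum_digits_le (X := varsAfter N m) (df := afterLabel m) (s := 3)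
    (t := N + 1) rfl h.le (fun v => (afterLabel_small m v).2) (by simp) (by
      refine (Finset.card_union_le _ _).trans ?_
      have h₃ := card_nums_le {1} N
      simp only [Finset.card_singleton] at h₃ ⊢; omega)
  have hc₃ := sum_digits_le (X := varsNext N m) (df := nextState) (s := 2)
    (t := N) rfl h.le (fun v => (nextState_small v).2) (by simp) (by
      have h₃ := card_nums_le {0} N
      simp only [Finset.card_singleton] at h₃; omega)
  have hB := h.mono.eight_le
  have htot : 600 * (2 * (N * (m + 1) ^ 2) * b + (m + 2 * N + 4) * B)
      + (600 * (3 * (N * (m + 1) ^ 2) * b + (N + 1) * B)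
      + 600 * (2 * (N * (m + 1) ^ 2) * b + N * B)) + 2 * B + 6 + 4 ≤ roundCost N m b B := by
    unfold roundCost; ring_nf; omega
  set P : Program := p ++ ([.predict (Var.num 4 0).reg] ++ ((q ++ q') ++ [.next, .jumpZero 0 0]))
    with hP
  have main : ∀ {n : ℕ} (a : Fin n → ZMod 2) (y : ZMod 2) (c : Config),
        (c.pc = 0 ∨ c.pc = p.length + (q ++ q').length + 2) → c.reg 0 = 0 →
        (∀ v : Var, c.reg v.reg ≤ bound N m v) →
        ∃ (M₁ M₂ : Var → ℕ) (T : ℕ) (c' : Config), P.size ≤ T + 4 ∧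
          Round P a y c (if M₁ (.num 4 0) = 0 then 0 else 1) T c' ∧
          T + 4 ≤ roundCost N m b B ∧ c'.pc = p.length + (q ++ q').length + 2 ∧ c'.reg 0 = 0 ∧
          IsRound N m σ a y (fun v => c.reg v.reg) M₁ M₂ (fun v => c'.reg v.reg) := by
    intro n a y ⟨r, R⟩ hr h0 hR
    obtain ⟨M₁, s₁, hM₁, e₁, n₁⟩ := hp a (fun v => R v.reg) hR
    have hy : y.val ≤ 1 := Nat.le_of_lt_succ (ZMod.val_lt y)
    have hup : ∀ v, Function.update M₁ (.num 4 0) y.val v ≤ bound N m v := by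
      intro v
      rcases eq_or_ne v (.num 4 0) with rfl | hv
      · rw [Function.update_self]; simp only [bound]; omega
      · rw [Function.update_of_ne hv]; exact hM₁ v
    obtain ⟨M₂, s₂, hM₂, e₂, n₂⟩ := hq a _ hup
    obtain ⟨M₃, s₃, hM₃, e₃, n₃⟩ := hq' a M₂ hM₂
    have hv := h.mono.num 4 0 (by norm_num) (Nat.zero_le _)
    obtain ⟨T, R', hround, hT, hsize, h0', hR'⟩ := round_of_sim (.num 4 0) s₁ (s₂.append s₃)
      (by omega : 1 ≤ B) hv ((hM₁ _).trans_lt ((bound_num_le N m 4 0 (Nat.zero_le _)).trans_lt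
        h.value)) h0 (fun _ => rfl) hr
    refine ⟨M₁, M₂, T, ⟨_, R'⟩, hsize, hround, by omega, rfl, h0', hR, fun v => ?_, hM₁, hM₂, e₁, n₁,
      e₂, fun v hv hne => ?_, ?_, fun v hv => ?_, fun v hv => ?_⟩
    · simpa [hR'] using hM₃ v
    · rw [n₂ v hv, Function.update_of_ne hne]
    · rw [n₂ _ (by simp), Function.update_self]
    · simp only [hR']; exact e₃ v hv
    · simp only [hR']; exact n₃ v hv
  refine ⟨P, p.length + (q ++ q').length + 2, ?_, fun a y c hc h0 hR => ?_⟩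
  -- The size is bounded by the cost of any one round; a round on zero variables serves.
  · obtain ⟨_, _, T, _, hs, _, hT, _⟩ := main (fun i : Fin 0 => 0) 0 Config.start (.inl rfl) rfl
      (fun v => Nat.zero_le _)
    exact hs.trans hT
  · obtain ⟨M₁, M₂, T, c', _, hr, hT, hrest⟩ := main a y c hc h0 hR
    exact ⟨M₁, M₂, T, c', hr, (Nat.le_add_right _ _).trans hT, hrest⟩

end ParityRAM

namespace ParityRAM
open ParityRAM.Expr

/-! ### Values of expressions for bits -/

section eval
variable {n : ℕ} {a : Fin n → ZMod 2} {M : Var → ℕ} {e f : Expr}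

theorem eval_neg : (neg e).eval a M = 1 - e.eval a M := rfl

theorem cast_eval_neg (he : e.eval a M ≤ 1) :
    (((neg e).eval a M : ℕ) : ZMod 2) = 1 + e.eval a M := by
  rw [eval_neg]
  generalize e.eval a M = x at *
  interval_cases x <;> decide

theorem cast_eval_xor (he : e.eval a M ≤ 1) (hf : f.eval a M ≤ 1) :
    (((Expr.xor e f).eval a M : ℕ) : ZMod 2) = e.eval a M + f.eval a M := by
  simp only [Expr.xor, eval]
  generalize e.eval a M = x at *
  generalize f.eval a M = y at *
  interval_cases x <;> interval_cases y <;> decide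

theorem eval_and_le (he : e.eval a M ≤ 1) (hf : f.eval a M ≤ 1) :
    (Expr.and e f).eval a M ≤ 1 := by
  simp only [Expr.and, eval]; omega

theorem cast_eval_and (he : e.eval a M ≤ 1) (hf : f.eval a M ≤ 1) :
    (((Expr.and e f).eval a M : ℕ) : ZMod 2) = e.eval a M * f.eval a M := by
  simp only [Expr.and, eval]
  generalize e.eval a M = x at *
  generalize f.eval a M = y at *
  interval_cases x <;> interval_cases y <;> decide

theorem eval_xor_le : (Expr.xor e f).eval a M ≤ 1 := Nat.sub_le _ _

theorem eval_query_le {c : ℕ} : (query c).eval a M ≤ 1 := coord_le a c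

theorem eval_neg_le : (neg e).eval a M ≤ 1 := Nat.sub_le _ _

theorem cast_eval_flipDiag (j l : ℕ) (he : e.eval a M ≤ 1) :
    (((flipDiag j l e).eval a M : ℕ) : ZMod 2) = (if j = l then 1 else 0) + e.eval a M := by
  unfold flipDiag
  split_ifs
  · exact cast_eval_neg he
  · simp

theorem eval_flipDiag_le (j l : ℕ) (he : e.eval a M ≤ 1) : (flipDiag j l e).eval a M ≤ 1 := by
  unfold flipDiag
  split_ifs
  · exact eval_neg_le
  · exact he

theorem eq_one_iff_cast_eq_one {x : ℕ} (hx : x ≤ 1) : x = 1 ↔ (x : ZMod 2) = 1 := by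
  interval_cases x <;> decide

theorem zmod_two_eq (x : ZMod 2) : x = 0 ∨ x = 1 := by revert x; decide

end eval

/-! ### Affine spaces represented by the memory, and their update in a round. -/

/-- Coordinate `l` of the `j`-th vector of the `i`-th affine space. -/
def vecVal (M : Var → ℕ) (i j l : ℕ) : ZMod 2 := (if j = l then 1 else 0) + (M (.bit 0 i j l) : ℕ)

/-- The scalar product of the example with the `j`-th vector of the `i`-th affine space. -/
def dot {n : ℕ} (m : ℕ) (σ : ℕ → ℕ → ℕ) (a : Fin n → ZMod 2) (M : Var → ℕ) (i j : ℕ) : ZMod 2 :=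
  ∑ l ∈ Finset.range m, (coord a (σ i l) : ZMod 2) * vecVal M i j l

theorem cast_eval_vec {n N m : ℕ} {a : Fin n → ZMod 2} {M : Var → ℕ}
    (hM : ∀ v, M v ≤ bound N m v) (i j l : ℕ) :
    (((vec i j l).eval a M : ℕ) : ZMod 2) = vecVal M i j l :=
  cast_eval_flipDiag j l (hM _)

theorem eval_vec_le {n N m : ℕ} {a : Fin n → ZMod 2} {M : Var → ℕ}
    (hM : ∀ v, M v ≤ bound N m v) (i j l : ℕ) : (vec i j l).eval a M ≤ 1 :=
  eval_flipDiag_le j l (hM _)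

namespace IsRound
variable {n N m : ℕ} {σ : ℕ → ℕ → ℕ} {a : Fin n → ZMod 2} {y : ZMod 2} {M M₁ M₂ M' : Var → ℕ}

theorem bit_le₁ (h : IsRound N m σ a y M M₁ M₂ M') (g i j l : ℕ) : M₁ (.bit g i j l) ≤ 1 := h.le₁ _

theorem bit_le₂ (h : IsRound N m σ a y M M₁ M₂ M') (g i j l : ℕ) : M₂ (.bit g i j l) ≤ 1 := h.le₂ _

theorem eval_bit_le₁ (h : IsRound N m σ a y M M₁ M₂ M') (g i j l : ℕ) :
    (var (.bit g i j l)).eval a M₁ ≤ 1 := h.le₁ _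

theorem eval_bit_le₂ (h : IsRound N m σ a y M M₁ M₂ M') (g i j l : ℕ) :
    (var (.bit g i j l)).eval a M₂ ≤ 1 := h.le₂ _

theorem vecVal₁ (h : IsRound N m σ a y M M₁ M₂ M') (i j l : ℕ) :
    vecVal M₁ i j l = vecVal M i j l := by
  unfold vecVal; rw [h.before_ne _ (by simp)]

theorem vecVal₂ (h : IsRound N m σ a y M M₁ M₂ M') (i j l : ℕ) :
    vecVal M₂ i j l = vecVal M i j l := by
  rw [← h.vecVal₁]; unfold vecVal; rw [h.after_ne _ (by simp) (by simp)]

theorem cast_bit_two (h : IsRound N m σ a y M M₁ M₂ M') {i j l : ℕ} (hi : i < N) (hj : j ≤ m)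
    (hl : l ≤ m) : (M₁ (.bit 2 i j l) : ZMod 2) =
      ∑ l' ∈ Finset.range l, (coord a (σ i l') : ZMod 2) * vecVal M i j l' := by
  induction l with
  | zero =>
    rw [h.before _ (by simp; omega)]
    simp [beforeLabel, eval]
  | succ l ih =>
    rw [h.before _ (by simp; omega), Finset.sum_range_succ, ← ih (by omega)]
    simp only [beforeLabel]
    rw [cast_eval_xor (h.eval_bit_le₁ _ _ _ _) (eval_and_le eval_query_le (eval_vec_le h.le₁ _ _ _)),
      cast_eval_and eval_query_le (eval_vec_le h.le₁ _ _ _), cast_eval_vec h.le₁, h.vecVal₁]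
    rfl

theorem cast_bit_two' (h : IsRound N m σ a y M M₁ M₂ M') {i j : ℕ} (hi : i < N) (hj : j ≤ m) :
    (M₁ (.bit 2 i j m) : ZMod 2) = dot m σ a M i j := h.cast_bit_two hi hj le_rfl

theorem bit_two_eq_one_iff (h : IsRound N m σ a y M M₁ M₂ M') {i j : ℕ} (hi : i < N) (hj : j ≤ m) :
    M₁ (.bit 2 i j m) = 1 ↔ dot m σ a M i j = 1 := by
  rw [eq_one_iff_cast_eq_one (h.bit_le₁ _ _ _ _), h.cast_bit_two' hi hj]

theorem bit_three_eq_one_iff (h : IsRound N m σ a y M M₁ M₂ M') {i j : ℕ} (hi : i < N)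
    (hj : j ≤ m) : M₁ (.bit 3 i j 0) = 1 ↔ ∃ j' < j, dot m σ a M i j' = 1 := by
  induction j with
  | zero =>
    rw [h.before _ (by simp; omega)]
    simp [beforeLabel, eval]
  | succ j ih =>
    rw [h.before _ (by simp; omega)]
    simp only [beforeLabel, Expr.or, eval]
    have h₁ := h.bit_le₁ 3 i j 0
    have h₂ := h.bit_le₁ 2 i j m
    have h₃ : 1 - (1 - (M₁ (.bit 3 i j 0) + M₁ (.bit 2 i j m))) = 1 ↔
        M₁ (.bit 3 i j 0) = 1 ∨ M₁ (.bit 2 i j m) = 1 := by omega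
    rw [h₃, ih (by omega), h.bit_two_eq_one_iff hi (by omega)]
    constructor
    · rintro (⟨j', hj', hd⟩ | hd)
      · exact ⟨j', by omega, hd⟩
      · exact ⟨j, by omega, hd⟩
    · rintro ⟨j', hj', hd⟩
      rcases Nat.lt_succ_iff_lt_or_eq.1 hj' with h' | rfl
      · exact .inl ⟨j', h', hd⟩
      · exact .inr hd

theorem tab_even (h : IsRound N m σ a y M M₁ M₂ M') {d : ℕ} (hd : d ≤ m) :
    M₁ (.tab (2 * d)) = 2 ^ (m - d) := by
  obtain ⟨r, rfl⟩ := Nat.exists_eq_add_of_le hd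
  clear hd
  have key : ∀ s d', d' + s = d + r → M₁ (.tab (2 * d')) = 2 ^ (d + r - d') := by
    intro s
    induction s with
    | zero =>
      intro d' hd'
      rw [h.before _ (by simp; omega)]
      simp only [Nat.add_zero] at hd'
      simp [beforeLabel, eval, hd']
    | succ s ih =>
      intro d' hd'
      rw [h.before _ (by simp; omega)]
      have h₁ := ih (d' + 1) (by omega)
      have h₂ : d + r - d' = d + r - (d' + 1) + 1 := by omega
      have h₃ : ¬ (2 * d' = 2 * (d + r)) := by omega
      simp only [beforeLabel, if_neg h₃, eval]
      rw [Nat.mul_add] at h₁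
      rw [h₁, h₂, pow_succ]
      ring
  exact key r d rfl

/-- The example is orthogonal to the direction of the `i`-th affine space, so that its label is the
same for all elements of this space. -/
def Decided {n : ℕ} (m : ℕ) (σ : ℕ → ℕ → ℕ) (a : Fin n → ZMod 2) (M : Var → ℕ) (i : ℕ) : Prop :=
  ∀ j < m, dot m σ a M i j ≠ 1

end IsRound

/-- The weight of the `i`-th affine space. -/
def weight (m : ℕ) (M : Var → ℕ) (i : ℕ) : ℕ :=
  if M (.bit 1 i 0 0) = 0 then 2 ^ (m - M (.num 0 i)) else 0

open Classical in
/-- The weight that the `i`-th affine space gives to the prediction `z`. -/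
noncomputable def voteFor {n : ℕ} (m : ℕ) (σ : ℕ → ℕ → ℕ) (a : Fin n → ZMod 2) (M : Var → ℕ)
    (z : ZMod 2) (i : ℕ) : ℕ :=
  if IsRound.Decided m σ a M i ∧ dot m σ a M i m = z then weight m M i else 0

namespace IsRound
variable {n N m : ℕ} {σ : ℕ → ℕ → ℕ} {a : Fin n → ZMod 2} {y : ZMod 2} {M M₁ M₂ M' : Var → ℕ}

theorem not_decided_iff (h : IsRound N m σ a y M M₁ M₂ M') {i : ℕ} (hi : i < N) :
    M₁ (.bit 3 i m 0) = 1 ↔ ¬Decided m σ a M i := by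
  rw [h.bit_three_eq_one_iff hi le_rfl]
  simp [Decided]

/-- The hypothesis `hodd` holds because no assignment writes an odd table entry; an index spoiled by
one of the three flags therefore loads 0. -/
theorem load_vote (h : IsRound N m σ a y M M₁ M₂ M') (hodd : ∀ e, M (.tab (2 * e + 1)) = 0)
    {i : ℕ} (hi : i < N) {q : Expr} (z : ZMod 2) (hq : q.eval a M₁ ≤ 1)
    (hqz : q.eval a M₁ = 0 ↔ dot m σ a M i m = z) :
    (load (vote i m q)).eval a M₁ = voteFor m σ a M z i := by
  have h₀ : M₁ (.num 0 i) = M (.num 0 i) := h.before_ne _ (by simp)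
  have h₁ : M₁ (.bit 1 i 0 0) = M (.bit 1 i 0 0) := h.before_ne _ (by simp)
  have h₂ := h.bit_le₁ 3 i m 0
  have h₃ := h.bit_le₁ 1 i 0 0
  have h₄ := h.not_decided_iff hi
  have h₅ : M (.num 0 i) ≤ m := h.le (.num 0 i)
  simp only [vote, Expr.or, eval, h₀, h₁] at h₃ ⊢
  generalize q.eval a M₁ = x at *
  by_cases hall : M (.bit 1 i 0 0) = 0 ∧ Decided m σ a M i ∧ dot m σ a M i m = z
  · have hF : M₁ (.bit 3 i m 0) = 0 := by
      by_contra hne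
      exact h₄.1 (by omega) hall.2.1
    rw [hF, hqz.2 hall.2.2, hall.1, voteFor, if_pos hall.2, weight, if_pos hall.1, ← h.tab_even h₅]
    congr 2; omega
  · have h₆ : M (.num 0 i) + M (.num 0 i) + (1 - (1 - (M (.bit 1 i 0 0) + x + M₁ (.bit 3 i m 0))))
        = 2 * M (.num 0 i) + 1 := by
      suffices M (.bit 1 i 0 0) + x + M₁ (.bit 3 i m 0) ≠ 0 by omega
      intro h0
      refine hall ⟨by omega, ?_, hqz.1 (by omega)⟩
      by_contra hnd
      have := h₄.2 hnd
      omega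
    rw [h₆, h.before_ne _ (by simp; omega), hodd, voteFor, weight]
    split_ifs with h₇ h₈
    · exact (hall ⟨h₈, h₇⟩).elim
    · rfl
    · rfl

theorem num_two (h : IsRound N m σ a y M M₁ M₂ M') (hodd : ∀ e, M (.tab (2 * e + 1)) = 0)
    {i : ℕ} (hi : i ≤ N) :
    M₁ (.num 2 i) = ∑ i' ∈ Finset.range i, voteFor m σ a M 0 i' := by
  induction i with
  | zero => rw [h.before _ (by simp)]; simp [beforeLabel, eval]
  | succ i ih =>
    rw [h.before _ (by simp; omega), Finset.sum_range_succ, ← ih (by omega),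
      ← h.load_vote hodd (by omega) (q := var (.bit 2 i m m)) 0 (h.bit_le₁ _ _ _ _)]
    · rfl
    · have h₁ := h.bit_two_eq_one_iff (by omega : i < N) le_rfl
      have h₂ := h.bit_le₁ 2 i m m
      simp only [eval]
      rcases zmod_two_eq (dot m σ a M i m) with h₃ | h₃
      · rw [h₃] at h₁ ⊢; simp at h₁ ⊢; omega
      · simp [h₃, h₁.2 h₃]

theorem num_three (h : IsRound N m σ a y M M₁ M₂ M') (hodd : ∀ e, M (.tab (2 * e + 1)) = 0)
    {i : ℕ} (hi : i ≤ N) :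
    M₁ (.num 3 i) = ∑ i' ∈ Finset.range i, voteFor m σ a M 1 i' := by
  induction i with
  | zero => rw [h.before _ (by simp)]; simp [beforeLabel, eval]
  | succ i ih =>
    rw [h.before _ (by simp; omega), Finset.sum_range_succ, ← ih (by omega),
      ← h.load_vote hodd (by omega) (q := neg (var (.bit 2 i m m))) 1 eval_neg_le]
    · rfl
    · have h₁ := h.bit_two_eq_one_iff (by omega : i < N) le_rfl
      have h₂ := h.bit_le₁ 2 i m m
      rw [← h₁]
      simp only [eval, neg]; omega

theorem prediction_eq_zero_iff (h : IsRound N m σ a y M M₁ M₂ M')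
    (hodd : ∀ e, M (.tab (2 * e + 1)) = 0) :
    M₁ (.num 4 0) = 0 ↔ ∑ i ∈ Finset.range N, voteFor m σ a M 1 i ≤
      ∑ i ∈ Finset.range N, voteFor m σ a M 0 i := by
  rw [h.before _ (by simp), ← h.num_two hodd le_rfl, ← h.num_three hodd le_rfl]
  simp only [beforeLabel, eval]; omega

theorem num_five (h : IsRound N m σ a y M M₁ M₂ M') : M₂ (.num 5 0) = y.val := by
  rw [h.after _ (by simp)]
  have hy : y.val ≤ 1 := Nat.le_of_lt_succ (ZMod.val_lt y)
  simp only [afterLabel, eval, h.label]; omega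

theorem bit_two₂ (h : IsRound N m σ a y M M₁ M₂ M') (i j l : ℕ) :
    M₂ (.bit 2 i j l) = M₁ (.bit 2 i j l) := h.after_ne _ (by simp) (by simp)

theorem bit_three₂ (h : IsRound N m σ a y M M₁ M₂ M') (i j l : ℕ) :
    M₂ (.bit 3 i j l) = M₁ (.bit 3 i j l) := h.after_ne _ (by simp) (by simp)

/-- With `j = m` this describes the pivot. Later arguments only need that it is some direction
vector with scalar product 1, or 0 if there is none. -/
theorem bit_four (h : IsRound N m σ a y M M₁ M₂ M') {i j : ℕ} (hi : i < N) (hj : j ≤ m) :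
    ((¬∃ j' < j, dot m σ a M i j' = 1) → ∀ l ≤ m, M₂ (.bit 4 i j l) = 0) ∧
    ((∃ j' < j, dot m σ a M i j' = 1) → ∃ j' < j, dot m σ a M i j' = 1 ∧
      ∀ l ≤ m, (M₂ (.bit 4 i j l) : ZMod 2) = vecVal M i j' l) := by
  induction j with
  | zero =>
    refine ⟨fun _ l hl => ?_, by simp⟩
    rw [h.after _ (by simp; omega)]
    simp [afterLabel, eval]
  | succ j ih =>
    obtain ⟨ih₀, ih₁⟩ := ih (by omega)
    have hF := h.bit_three_eq_one_iff hi (by omega : j ≤ m)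
    have hD := h.bit_two_eq_one_iff hi (by omega : j ≤ m)
    have hF' := h.bit_le₁ 3 i j 0
    have hD' := h.bit_le₁ 2 i j m
    have hrec : ∀ l ≤ m, M₂ (.bit 4 i (j + 1) l) = 1 - (1 - (M₂ (.bit 4 i j l) +
        ((vec i j l).eval a M₂ + (M₁ (.bit 2 i j m) - M₁ (.bit 3 i j 0)) - 1))) := by
      intro l hl
      rw [h.after _ (by simp; omega)]
      simp only [afterLabel, Expr.or, Expr.and, eval, h.bit_two₂, h.bit_three₂]
    have hv := fun l => eval_vec_le (a := a) h.le₂ i j l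
    have hU := fun l => h.bit_le₂ 4 i j l
    by_cases hf : ∃ j' < j, dot m σ a M i j' = 1
    · obtain ⟨j', hj', hd, hu⟩ := ih₁ hf
      refine ⟨fun hn => (hn ⟨j', by omega, hd⟩).elim, fun _ => ⟨j', by omega, hd, fun l hl => ?_⟩⟩
      rw [← hu l hl, hrec l hl, hF.2 hf]
      have := hv l
      have := hU l
      congr 1
      omega
    · have h0 : M₁ (.bit 3 i j 0) = 0 := by
        by_contra hne
        exact hf (hF.1 (by omega))
      by_cases hd : dot m σ a M i j = 1
      · refine ⟨fun hn => (hn ⟨j, by omega, hd⟩).elim, fun _ => ⟨j, by omega, hd, fun l hl => ?_⟩⟩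
        rw [← h.vecVal₂, ← cast_eval_vec (a := a) h.le₂, hrec l hl, h0, ih₀ hf l hl, hD.2 hd]
        have := hv l
        congr 1
        omega
      · have hD0 : M₁ (.bit 2 i j m) = 0 := by
          by_contra hne
          exact hd (hD.1 (by omega))
        have hn : ¬∃ j' < j + 1, dot m σ a M i j' = 1 := by
          rintro ⟨j', hj', hd'⟩
          rcases Nat.lt_succ_iff_lt_or_eq.1 hj' with h' | rfl
          · exact hf ⟨j', h', hd'⟩
          · exact hd hd'
        refine ⟨fun _ l hl => ?_, fun hp => (hn hp).elim⟩
        rw [hrec l hl, h0, hD0, ih₀ hf l hl]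
        have := hv l
        omega

/-- The coefficient of the pivot vector in the change of the `j`-th vector. -/
def coeff {n : ℕ} (m : ℕ) (σ : ℕ → ℕ → ℕ) (a : Fin n → ZMod 2) (y : ZMod 2) (M : Var → ℕ)
    (i j : ℕ) : ZMod 2 :=
  if j = m then dot m σ a M i m + y else dot m σ a M i j

theorem cast_label (y : ZMod 2) : ((y.val : ℕ) : ZMod 2) = y := ZMod.natCast_zmod_val y

/-- This is an elimination step. Adding the right multiple of the pivot makes every direction vector
orthogonal to the example and moves the base point, which is row `m`, to label `y`; the pivot itself
becomes 0. Without a pivot nothing changes. -/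
theorem vecVal_next (h : IsRound N m σ a y M M₁ M₂ M') {i j l : ℕ} (hi : i < N) (hj : j ≤ m)
    (hl : l ≤ m) :
    vecVal M' i j l = vecVal M i j l + M₂ (.bit 4 i m l) * coeff m σ a y M i j := by
  have hy : (var (.num 5 0)).eval a M₂ ≤ 1 := h.le₂ (.num 5 0)
  set s := if j = m then Expr.xor (var (.bit 2 i m m)) (var (.num 5 0))
    else var (.bit 2 i j m) with hs
  have hs₁ : s.eval a M₂ ≤ 1 := by
    rw [hs]; split_ifs
    · exact eval_xor_le
    · exact h.bit_le₂ _ _ _ _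
  have hs₂ : ((s.eval a M₂ : ℕ) : ZMod 2) = coeff m σ a y M i j := by
    rw [hs, coeff]; split_ifs
    · rw [cast_eval_xor (h.eval_bit_le₂ _ _ _ _) hy]
      simp only [eval, h.bit_two₂, h.cast_bit_two' hi le_rfl, h.num_five, cast_label]
    · simp only [eval, h.bit_two₂, h.cast_bit_two' hi hj]
  have h₁ : M' (.bit 0 i j l) = M₂ (.bit 5 i j l) := by
    rw [h.next _ (by simp; omega)]
    exact h.next_ne _ (by simp)
  have h₂ : (M₂ (.bit 5 i j l) : ZMod 2) = (if j = l then 1 else 0) +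
      (vecVal M i j l + M₂ (.bit 4 i m l) * coeff m σ a y M i j) := by
    rw [h.after _ (by simp; omega)]
    simp only [afterLabel, ← hs]
    rw [cast_eval_flipDiag _ _ eval_xor_le, cast_eval_xor (eval_vec_le h.le₂ _ _ _)
      (eval_and_le (h.eval_bit_le₂ _ _ _ _) hs₁), cast_eval_and (h.eval_bit_le₂ _ _ _ _) hs₁,
      cast_eval_vec h.le₂, h.vecVal₂, hs₂]
    rfl
  conv_lhs => rw [vecVal]
  -- The identity matrix is added once in the stored form and once in `vecVal`, and cancels in
  -- characteristic 2.
  rw [h₁, h₂, ← add_assoc, CharTwo.add_self_eq_zero, zero_add]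

theorem num_zero_next (h : IsRound N m σ a y M M₁ M₂ M') {i : ℕ} (hi : i < N) :
    M' (.num 0 i) = min m (M (.num 0 i) + M₁ (.bit 3 i m 0)) := by
  rw [h.next _ (by simp; omega)]
  simp only [nextState, eval]
  rw [h.next_ne _ (by simp), h.after _ (by simp; omega)]
  simp only [afterLabel, eval, h.bit_three₂]
  rw [h.after_ne _ (by simp) (by simp), h.before_ne _ (by simp)]
  omega

theorem bit_one_next (h : IsRound N m σ a y M M₁ M₂ M') {i : ℕ} (hi : i < N) :
    M' (.bit 1 i 0 0) = 0 ↔ M (.bit 1 i 0 0) = 0 ∧ (Decided m σ a M i → dot m σ a M i m = y) := by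
  have hF := h.bit_le₁ 3 i m 0
  have hd := h.not_decided_iff hi
  have hy : (var (.num 5 0)).eval a M₂ ≤ 1 := h.le₂ (.num 5 0)
  have hx : (Expr.xor (var (.bit 2 i m m)) (var (.num 5 0))).eval a M₂ ≤ 1 := eval_xor_le
  have hx' : (Expr.xor (var (.bit 2 i m m)) (var (.num 5 0))).eval a M₂ = 1 ↔
      dot m σ a M i m ≠ y := by
    rw [eq_one_iff_cast_eq_one hx, cast_eval_xor (h.eval_bit_le₂ _ _ _ _) hy]
    simp only [eval, h.bit_two₂, h.cast_bit_two' hi le_rfl, h.num_five, cast_label]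
    generalize dot m σ a M i m = s
    clear * -
    revert s y; decide
  rw [h.next _ (by simp; omega)]
  simp only [nextState, eval]
  rw [h.next_ne _ (by simp), h.after _ (by simp; omega)]
  simp only [afterLabel]
  generalize (Expr.xor (var (.bit 2 i m m)) (var (.num 5 0))) = e at *
  simp only [Expr.or, eval, h.bit_three₂]
  rw [h.after_ne _ (by simp) (by simp), h.before_ne (.bit 1 i 0 0) (by simp)]
  generalize e.eval a M₂ = x at *
  by_cases hD : Decided m σ a M i <;> by_cases hq : dot m σ a M i m = y <;>
    simp only [hD, hq, not_true, not_false_iff, iff_true, iff_false, ne_eq, true_imp_iff,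
      false_imp_iff, and_true, and_false] at hd hx' ⊢ <;> omega

end IsRound

/-! ### Invariants and the halving of the total weight. -/

/-- The number of vectors of the `i`-th affine space that have been replaced by `0`. -/
def zeros (m : ℕ) (M : Var → ℕ) (i : ℕ) : ℕ :=
  ((Finset.range m).filter fun j => ∀ l ∈ Finset.range m, vecVal M i j l = 0).card

/-- The invariant of the learning program between rounds. -/
structure Inv (N m : ℕ) (M : Var → ℕ) : Prop where
  le : ∀ v, M v ≤ bound N m v
  odd : ∀ e, M (.tab (2 * e + 1)) = 0
  rank : ∀ i < N, M (.num 0 i) ≤ zeros m M i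

/-- The `i`-th affine space has not been discarded and contains `z`. -/
def Covers (m : ℕ) (M : Var → ℕ) (z : ℕ → ZMod 2) (i : ℕ) : Prop :=
  M (.bit 1 i 0 0) = 0 ∧ ∃ c : ℕ → ZMod 2, ∀ l < m,
    z l = vecVal M i m l + ∑ j ∈ Finset.range m, c j * vecVal M i j l

theorem inv_zero (N m : ℕ) : Inv N m fun _ => 0 :=
  ⟨fun _ => Nat.zero_le _, fun _ => rfl, fun _ _ => Nat.zero_le _⟩

/-- Since vectors are stored up to the identity matrix, empty memory encodes base point 0 and the
standard basis, that is, the whole space. No initialization is needed, and the coefficients are `z`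
itself. -/
theorem covers_zero (m : ℕ) (z : ℕ → ZMod 2) (i : ℕ) : Covers m (fun _ => 0) z i := by
  refine ⟨rfl, z, fun l hl => ?_⟩
  simp [vecVal, hl, hl.ne']

namespace IsRound
variable {n N m : ℕ} {σ : ℕ → ℕ → ℕ} {a : Fin n → ZMod 2} {y : ZMod 2} {M M₁ M₂ M' : Var → ℕ}

theorem dot_eq_zero_of_forall {i j : ℕ} (hz : ∀ l ∈ Finset.range m, vecVal M i j l = 0) :
    dot m σ a M i j = 0 :=
  Finset.sum_eq_zero fun l hl => by rw [hz l hl, mul_zero]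

theorem zeros_subset (h : IsRound N m σ a y M M₁ M₂ M') {i : ℕ} (hi : i < N) :
    ((Finset.range m).filter fun j => ∀ l ∈ Finset.range m, vecVal M i j l = 0) ⊆
      (Finset.range m).filter fun j => ∀ l ∈ Finset.range m, vecVal M' i j l = 0 := by
  intro j hj
  simp only [Finset.mem_filter] at hj ⊢
  refine ⟨hj.1, fun l hl => ?_⟩
  have hjm := Finset.mem_range.1 hj.1
  rw [h.vecVal_next hi hjm.le (Finset.mem_range.1 hl).le, hj.2 l hl, coeff, if_neg hjm.ne,
    dot_eq_zero_of_forall hj.2, mul_zero, zero_add]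

/-- Zero vectors stay zero, and the pivot, nonzero before, becomes zero. Hence the counter `num 0 i`
is still below `m` when a space is cut, and its weight is halved exactly. -/
theorem zeros_lt (h : IsRound N m σ a y M M₁ M₂ M') {i : ℕ} (hi : i < N)
    (hd : ¬Decided m σ a M i) : zeros m M i + 1 ≤ zeros m M' i ∧ zeros m M i < m := by
  have hex : ∃ j < m, dot m σ a M i j = 1 := by simpa [Decided] using hd
  obtain ⟨j, hj, hdj, hu⟩ := (h.bit_four hi le_rfl).2 hex
  have hnot : j ∉ (Finset.range m).filter fun j => ∀ l ∈ Finset.range m, vecVal M i j l = 0 := by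
    intro hmem
    rw [dot_eq_zero_of_forall (Finset.mem_filter.1 hmem).2] at hdj
    exact zero_ne_one hdj
  have hlt : zeros m M i + 1 ≤ zeros m M' i := by
    refine Finset.card_lt_card ((Finset.ssubset_iff_of_subset (h.zeros_subset hi)).2
      ⟨j, ?_, hnot⟩)
    refine Finset.mem_filter.2 ⟨Finset.mem_range.2 hj, fun l hl => ?_⟩
    have hl' := (Finset.mem_range.1 hl).le
    rw [h.vecVal_next hi hj.le hl', hu l hl', coeff, if_neg hj.ne, hdj, mul_one,
      CharTwo.add_self_eq_zero]
  have hle : zeros m M' i ≤ m := (Finset.card_filter_le _ _).trans_eq (Finset.card_range m)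
  exact ⟨hlt, by omega⟩

theorem inv (h : IsRound N m σ a y M M₁ M₂ M') (hM : Inv N m M) : Inv N m M' where
  le := h.le'
  odd e := by
    rw [h.next_ne _ (by simp), h.after_ne _ (by simp) (by simp),
      h.before_ne _ (by simp; omega), hM.odd]
  rank i hi := by
    have hr := hM.rank i hi
    have hF := h.bit_le₁ 3 i m 0
    rw [h.num_zero_next hi]
    by_cases hd : Decided m σ a M i
    · have : M₁ (.bit 3 i m 0) ≠ 1 := fun h1 => (h.not_decided_iff hi).1 h1 hd
      have := Finset.card_le_card (h.zeros_subset hi)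
      unfold zeros at *
      omega
    · have := (h.zeros_lt hi hd).1
      omega

/-- Let `w` be the old weight. An undecided space is halved and does not vote, so both sides are
`w`. A space deciding for `y` is kept, so both sides are `2 * w`. A space deciding for `y + 1` is
discarded, so both sides are `w`. -/
theorem two_mul_weight (h : IsRound N m σ a y M M₁ M₂ M') (hM : Inv N m M) {i : ℕ} (hi : i < N) :
    2 * weight m M' i + voteFor m σ a M (y + 1) i = weight m M i + voteFor m σ a M y i := by
  have hF := h.bit_le₁ 3 i m 0
  have hd := h.not_decided_iff hi
  have hr : M (.num 0 i) ≤ m := h.le (.num 0 i)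
  have hdead := h.bit_one_next hi
  simp only [weight, voteFor, h.num_zero_next hi]
  by_cases hD : Decided m σ a M i
  · have h0 : M₁ (.bit 3 i m 0) = 0 := by
      have : M₁ (.bit 3 i m 0) ≠ 1 := fun h1 => hd.1 h1 hD
      omega
    by_cases hq : dot m σ a M i m = y
    · have hne : y ≠ y + 1 := by clear * -; revert y; decide
      simp only [hD, hq, hne, h0, hdead, Nat.add_zero, min_eq_right hr, true_and, and_true,
        if_true, if_false, imp_self]
      omega
    · have hq' : dot m σ a M i m = y + 1 := by
        generalize dot m σ a M i m = s at *
        clear * - hq; revert s y; decide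
      have hne : y + 1 ≠ y := by clear * -; revert y; decide
      simp [hD, hq', hdead]
  · have hz := (h.zeros_lt hi hD).2
    have hr' := hM.rank i hi
    have h1 : M₁ (.bit 3 i m 0) = 1 := hd.2 hD
    have h2 : m - M (.num 0 i) = m - (M (.num 0 i) + 1) + 1 := by omega
    simp only [hD, h1, hdead, false_and, if_false, false_imp_iff, and_true, Nat.add_zero,
      min_eq_right (by omega : M (.num 0 i) + 1 ≤ m)]
    split_ifs
    · rw [h2, pow_succ]; ring
    · rfl

theorem sum_weight_le (h : IsRound N m σ a y M M₁ M₂ M') (hM : Inv N m M) :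
    ∑ i ∈ Finset.range N, weight m M' i ≤ ∑ i ∈ Finset.range N, weight m M i := by
  refine Finset.sum_le_sum fun i hi => ?_
  have h₁ := h.two_mul_weight hM (Finset.mem_range.1 hi)
  have h₂ : voteFor m σ a M y i ≤ weight m M i := by unfold voteFor; split <;> omega
  omega

/-- After a mistake the votes for `y + 1` weigh at least as much as those for `y`, ties included; it
remains to sum `two_mul_weight`. -/
theorem two_mul_sum_weight_le (h : IsRound N m σ a y M M₁ M₂ M') (hM : Inv N m M)
    (hne : (if M₁ (.num 4 0) = 0 then 0 else 1) ≠ y) :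
    2 * ∑ i ∈ Finset.range N, weight m M' i ≤ ∑ i ∈ Finset.range N, weight m M i := by
  have h₁ : 2 * ∑ i ∈ Finset.range N, weight m M' i
      + ∑ i ∈ Finset.range N, voteFor m σ a M (y + 1) i =
      ∑ i ∈ Finset.range N, weight m M i + ∑ i ∈ Finset.range N, voteFor m σ a M y i := by
    rw [Finset.mul_sum, ← Finset.sum_add_distrib, ← Finset.sum_add_distrib]
    exact Finset.sum_congr rfl fun i hi => h.two_mul_weight hM (Finset.mem_range.1 hi)
  have h₂ := h.prediction_eq_zero_iff hM.odd
  have h₃ : (1 + 1 : ZMod 2) = 0 := by decide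
  rcases zmod_two_eq y with rfl | rfl
  · simp only [zero_add] at h₁
    have : ¬ M₁ (.num 4 0) = 0 := by rintro h0; simp [h0] at hne
    rw [h₂] at this
    omega
  · rw [h₃] at h₁
    have : M₁ (.num 4 0) = 0 := by by_contra h0; simp [h0] at hne
    rw [h₂] at this
    omega

/-- The coefficients `c` of the target never change. The update adds to the combination the pivot
times `dot m + y + ∑ c j * dot j`, and this scalar vanishes because `z` has label `y`. -/
theorem covers (h : IsRound N m σ a y M M₁ M₂ M') {z : ℕ → ZMod 2} {i : ℕ} (hi : i < N)
    (hc : Covers m M z i) (hy : ∑ l ∈ Finset.range m, (coord a (σ i l) : ZMod 2) * z l = y) :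
    Covers m M' z i := by
  obtain ⟨hdead, c, hz⟩ := hc
  have hy' : y = dot m σ a M i m + ∑ j ∈ Finset.range m, c j * dot m σ a M i j := by
    rw [← hy]
    have : ∀ l ∈ Finset.range m, (coord a (σ i l) : ZMod 2) * z l =
        (coord a (σ i l) : ZMod 2) * vecVal M i m l +
          ∑ j ∈ Finset.range m, c j * ((coord a (σ i l) : ZMod 2) * vecVal M i j l) := by
      intro l hl
      rw [hz l (Finset.mem_range.1 hl), mul_add, Finset.mul_sum]
      congr 1
      exact Finset.sum_congr rfl fun j _ => by ring
    rw [Finset.sum_congr rfl this, Finset.sum_add_distrib, Finset.sum_comm]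
    simp only [dot, Finset.mul_sum]
  refine ⟨(h.bit_one_next hi).2 ⟨hdead, fun hD => ?_⟩, c, fun l hl => ?_⟩
  · rw [hy', Finset.sum_eq_zero, add_zero]
    intro j hj
    rcases zmod_two_eq (dot m σ a M i j) with h0 | h1
    · rw [h0, mul_zero]
    · exact (hD j (Finset.mem_range.1 hj) h1).elim
  · have h₁ : ∀ j ∈ Finset.range m, c j * vecVal M' i j l =
        c j * vecVal M i j l + M₂ (.bit 4 i m l) * (c j * dot m σ a M i j) := by
      intro j hj
      have hjm := Finset.mem_range.1 hj
      rw [h.vecVal_next hi hjm.le hl.le, coeff, if_neg hjm.ne]; ring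
    rw [Finset.sum_congr rfl h₁, Finset.sum_add_distrib, ← Finset.mul_sum,
      h.vecVal_next hi le_rfl hl.le, coeff, if_pos rfl, hz l hl]
    have h₂ : dot m σ a M i m + y + ∑ j ∈ Finset.range m, c j * dot m σ a M i j = 0 := by
      rw [hy']
      generalize dot m σ a M i m = p
      generalize ∑ j ∈ Finset.range m, c j * dot m σ a M i j = q
      clear * -; revert p q; decide
    have h₃ : (M₂ (.bit 4 i m l) : ZMod 2) * (dot m σ a M i m + y) +
        M₂ (.bit 4 i m l) * ∑ j ∈ Finset.range m, c j * dot m σ a M i j = 0 := by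
      rw [← mul_add, h₂, mul_zero]
    linear_combination -h₃

end IsRound

/-- The potential `2 ^ mistakes * W` never grows beyond its initial value `N * 2 ^ m`, while `W ≥ 1`
because space `i` keeps covering the target. -/
theorem exists_learner {N m : ℕ} {σ : ℕ → ℕ → ℕ} {b B : ℕ} (h : Large N m σ b B) (n k : ℕ)
    (hcov : ∀ x : Fin n → ZMod 2, hammingNorm x = k → ∃ i < N, ∃ z : ℕ → ZMod 2,
      ∀ a : Fin n → ZMod 2,
        ∑ l ∈ Finset.range m, (coord a (σ i l) : ZMod 2) * z l = a ⬝ᵥ x) :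
    ∃ P : Program, P.size ≤ roundCost N m b B ∧
      LearnsParities P n k (m + Real.logb 2 N) (roundCost N m b B) := by
  obtain ⟨P, L, hsize, hP⟩ := exists_program h
  refine ⟨P, hsize, fun x hx a => ?_⟩
  obtain ⟨i, hi, z, hz⟩ := hcov x hx
  let val : Config → Var → ℕ := fun c v => c.reg v.reg
  let W : Config → ℕ := fun c => ∑ i ∈ Finset.range N, weight m (val c) i
  let Good : Config → Prop := fun c =>
    (c.pc = 0 ∨ c.pc = L) ∧ c.reg 0 = 0 ∧ Inv N m (val c) ∧ Covers m (val c) z i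
  have hstep : ∀ (j : ℕ) (c : {c // Good c}), ∃ (c' : {c // Good c}) (p : ZMod 2) (T : ℕ),
      Round P (a j) (a j ⬝ᵥ x) c.1 p T c'.1 ∧ T ≤ roundCost N m b B ∧ W c'.1 ≤ W c.1 ∧
      (p ≠ a j ⬝ᵥ x → 2 * W c'.1 ≤ W c.1) := by
    rintro j ⟨c, hpc, h0, hinv, hc⟩
    obtain ⟨M₁, M₂, T, c', hr, hT, hpc', h0', hM⟩ := hP (a j) (a j ⬝ᵥ x) c hpc h0 hinv.le
    exact ⟨⟨c', .inr hpc', h0', hM.inv hinv, hM.covers hi hc (hz (a j))⟩, _, T, hr, hT,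
      hM.sum_weight_le hinv, hM.two_mul_sum_weight_le hinv⟩
  choose nx bs Ts hround hTs hW hW2 using hstep
  let start : {c // Good c} := ⟨Config.start, .inl rfl, rfl, inv_zero N m, covers_zero m z i⟩
  let cs : ℕ → {c // Good c} := fun j => Nat.rec start (fun j c => nx j c) j
  refine ⟨fun j => (cs j).1, fun j => bs j (cs j), fun j => Ts j (cs j), rfl,
    fun j => hround j (cs j), fun j => by exact_mod_cast hTs j (cs j), fun r => ?_⟩
  set mist : ℕ → ℕ := fun r =>
    ((Finset.range r).filter fun j => bs j (cs j) ≠ a j ⬝ᵥ x).card with hmist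
  have hpot : ∀ r, 2 ^ mist r * W (cs r).1 ≤ N * 2 ^ m := by
    intro r
    induction r with
    | zero =>
      have h₁ : mist 0 = 0 := by simp [hmist]
      have h₂ : W (cs 0).1 = N * 2 ^ m := by
        simp [cs, start, W, val, Config.start, weight]
      rw [h₁, h₂, pow_zero, one_mul]
    | succ r ih =>
      simp only [hmist] at ih ⊢
      rw [Finset.range_add_one, Finset.filter_insert]
      have e : cs (r + 1) = nx r (cs r) := rfl
      split_ifs with hb
      · rw [Finset.card_insert_of_notMem (by simp), pow_succ, mul_assoc, e]
        exact (Nat.mul_le_mul_left _ (hW2 r (cs r) hb)).trans ih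
      · rw [e]
        exact (Nat.mul_le_mul_left _ (hW r (cs r))).trans ih
  have hpos : 1 ≤ W (cs r).1 := by
    have hdead := (cs r).2.2.2.2.1
    refine le_trans ?_ (Finset.single_le_sum (f := fun i => weight m (val (cs r).1) i)
      (fun _ _ => Nat.zero_le _) (Finset.mem_range.2 hi))
    simp only [weight, hdead, if_true]
    exact Nat.one_le_two_pow
  have hle : 2 ^ mist r ≤ N * 2 ^ m := (Nat.le_mul_of_pos_right _ hpos).trans (hpot r)
  have hN : (0 : ℝ) < N := by exact_mod_cast (Nat.zero_le i).trans_lt hi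
  have hle' : ((2 : ℝ) ^ mist r) ≤ N * 2 ^ m := by exact_mod_cast hle
  have hlog := Real.logb_le_logb_of_le (b := 2) (by norm_num) (by positivity) hle'
  rw [Real.logb_mul hN.ne' (by positivity), Real.logb_pow, Real.logb_pow,
    Real.logb_self_eq_one (by norm_num)] at hlog
  linarith

/-! ### Explicit digit bounds, and learning from a covering. -/

theorem lt_two_pow_len (x : ℕ) : x < 2 ^ len x := Nat.lt_pow_succ_log_self (by norm_num) x

theorem pair_lt_sq {a b q : ℕ} (ha : a < q) (hb : b < q) : Nat.pair a b < q ^ 2 :=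
  (Nat.pair_lt_max_add_one_sq a b).trans_le (Nat.pow_le_pow_left (by omega) 2)

/-- A bit is named by a nested pairing of four numbers below `q`, so its register is below `4 * q ^
4 + 3`, hence below `q ^ 5`; this explains the factor 5. Values of weights need `m` more digits. -/
theorem large_of_le {N m n : ℕ} {σ : ℕ → ℕ → ℕ} (hσ : ∀ i < N, ∀ l < m, σ i l ≤ n) :
    Large N m σ (5 * len (N + m + n + 20)) (5 * len (N + m + n + 20) + m) := by
  set q := N + m + n + 20 with hq
  have hlen := lt_two_pow_len q
  have h5 : q ^ 5 ≤ 2 ^ (5 * len q) := by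
    rw [mul_comm, pow_mul]; exact Nat.pow_le_pow_left hlen.le 5
  have h20 : 20 ≤ q := by omega
  have hq1 : q ≤ q ^ 5 := Nat.le_self_pow (by norm_num) q
  have hq2 : 20 * q ≤ q ^ 5 := by
    calc 20 * q ≤ q ^ 4 * q := Nat.mul_le_mul_right _ (h20.trans (Nat.le_self_pow (by norm_num) q))
      _ = q ^ 5 := by ring
  have hq3 : 20 * q ^ 2 ≤ q ^ 5 := by
    calc 20 * q ^ 2 ≤ q ^ 3 * q ^ 2 :=
          Nat.mul_le_mul_right _ (h20.trans (Nat.le_self_pow (by norm_num) q))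
      _ = q ^ 5 := by ring
  have hq4 : 20 * q ^ 4 ≤ q ^ 5 := by
    calc 20 * q ^ 4 ≤ q * q ^ 4 := Nat.mul_le_mul_right _ h20
      _ = q ^ 5 := by ring
  have h5len : 4 ≤ len q := by
    unfold len
    have : Nat.log 2 8 ≤ Nat.log 2 q := Nat.log_mono_right (by omega)
    have h8 : Nat.log 2 8 = 3 := by rw [show 8 = 2 ^ 3 by norm_num, Nat.log_pow (by norm_num)]
    omega
  refine ⟨by omega, Nat.le_add_right _ _, fun g i j l hg hi hj hl => ?_, fun g i hg hi => ?_,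
    fun e he => ?_, fun i l hi hl => ?_, ?_⟩
  · have h₁ := pair_lt_sq (by omega : g < q) (by omega : i < q)
    have h₂ := pair_lt_sq (by omega : j < q) (by omega : l < q)
    have h₃ := pair_lt_sq h₁ h₂
    rw [← pow_mul, show 2 * 2 = 4 from rfl] at h₃
    simp only [Var.reg]; omega
  · have h₁ := pair_lt_sq (by omega : g < q) (by omega : i < q)
    simp only [Var.reg]; omega
  · simp only [Var.reg]; omega
  · have := hσ i hi l hl
    omega
  · have h2 : 1 ≤ 2 ^ m := Nat.one_le_two_pow
    calc (N + 1) * 2 ^ m + 1 ≤ (N + 1) * 2 ^ m + 2 ^ m := by omega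
      _ = (N + 2) * 2 ^ m := by ring
      _ ≤ q * 2 ^ m := Nat.mul_le_mul_right _ (by omega)
      _ < 2 ^ (5 * len q) * 2 ^ m := by
          apply Nat.mul_lt_mul_of_pos_right _ (by omega)
          omega
      _ = 2 ^ (5 * len q + m) := (pow_add _ _ _).symm

theorem roundCost_le {N m b : ℕ} (hN : 1 ≤ N) (hb : 1 ≤ b) :
    roundCost N m b (b + m) ≤ 10200 * (N * (m + 1) ^ 2) * b := by
  have h₁ : m + 4 * N + 6 ≤ 10 * (N * (m + 1)) := by nlinarith
  have h₂ : b + m ≤ (m + 1) * b := by nlinarith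
  calc roundCost N m b (b + m)
      ≤ 600 * (7 * (N * (m + 1) ^ 2) * b + 10 * (N * (m + 1)) * ((m + 1) * b)) := by
        unfold roundCost; gcongr
    _ = _ := by ring

/-- If every target is determined by its restriction to one of `N` families of `m` coordinates, then
the class of parities can be learned with at most `m + log₂ N` mistakes. -/
theorem exists_learner_of_cover {N m n k : ℕ} {σ : ℕ → ℕ → ℕ} (hN : 1 ≤ N)
    (hσ : ∀ i < N, ∀ l < m, σ i l ≤ n)
    (hcov : ∀ x : Fin n → ZMod 2, hammingNorm x = k → ∃ i < N, ∃ z : ℕ → ZMod 2,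
      ∀ a : Fin n → ZMod 2,
        ∑ l ∈ Finset.range m, (coord a (σ i l) : ZMod 2) * z l = a ⬝ᵥ x) :
    ∃ P : Program, P.size ≤ 51000 * (N * (m + 1) ^ 2) * len (N + m + n + 20) ∧
      LearnsParities P n k (m + Real.logb 2 N)
        (51000 * (N * (m + 1) ^ 2) * len (N + m + n + 20) : ℕ) := by
  have hL := large_of_le hσ
  have hc := roundCost_le (m := m) hN (hL.eight_le.trans' (by norm_num))
  have hc' : roundCost N m (5 * len (N + m + n + 20)) (5 * len (N + m + n + 20) + m) ≤
      51000 * (N * (m + 1) ^ 2) * len (N + m + n + 20) := hc.trans_eq (by ring)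
  obtain ⟨P, hP, hl⟩ := exists_learner hL n k hcov
  refine ⟨P, hP.trans hc', fun x hx a => ?_⟩
  obtain ⟨c, b, T, h₁, h₂, h₃, h₄⟩ := hl x hx a
  exact ⟨c, b, T, h₁, h₂, fun j => (h₃ j).trans (by exact_mod_cast hc'), h₄⟩

end ParityRAM

/-! ### Coverings -/

/-- If every element of `X` is related to a proportion `ρ` of the elements of `Y`, then `N` elements
of `Y` can be chosen such that at most a proportion `(1 - ρ) ^ N` of `X` remains unrelated to them. -/
theorem exists_greedy_cover {α β : Type*} (X : Finset α) (Y : Finset β) (hY : Y.Nonempty)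
    (rel : α → β → Prop) [∀ x y, Decidable (rel x y)] {ρ : ℝ}
    (hρ : ∀ x ∈ X, ρ * Y.card ≤ (Y.filter fun y => rel x y).card) (N : ℕ) :
    ∃ f : ℕ → β, (∀ i, f i ∈ Y) ∧
      ((X.filter fun x => ∀ i < N, ¬rel x (f i)).card : ℝ) ≤ X.card * (1 - ρ) ^ N := by
  induction N with
  | zero =>
    obtain ⟨y, hy⟩ := hY
    exact ⟨fun _ => y, fun _ => hy, by simp⟩
  | succ N ih =>
    obtain ⟨f, hf, hle⟩ := ih
    set U := X.filter fun x => ∀ i < N, ¬rel x (f i) with hU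
    have hYpos : (0 : ℝ) < Y.card := by exact_mod_cast hY.card_pos
    have hdouble : ρ * Y.card * U.card ≤ ∑ y ∈ Y, ((U.filter fun x => rel x y).card : ℝ) := by
      have h₁ : ∑ y ∈ Y, (U.filter fun x => rel x y).card =
          ∑ x ∈ U, (Y.filter fun y => rel x y).card := by
        simp only [Finset.card_filter]
        exact Finset.sum_comm
      have h₂ : ∑ x ∈ U, ρ * (Y.card : ℝ) ≤ ∑ x ∈ U, ((Y.filter fun y => rel x y).card : ℝ) :=
        Finset.sum_le_sum fun x hx => hρ x (Finset.mem_of_mem_filter x hx)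
      rw [Finset.sum_const, nsmul_eq_mul, mul_comm] at h₂
      rw [← Nat.cast_sum, h₁, Nat.cast_sum]
      exact h₂
    -- Greedy choice: by double counting, some `y` is related to a proportion `ρ` of what is still
    -- uncovered.
    obtain ⟨y, hy, hyU⟩ : ∃ y ∈ Y, ρ * U.card ≤ ((U.filter fun x => rel x y).card : ℝ) := by
      refine Finset.exists_le_of_sum_le hY ?_
      rw [Finset.sum_const, nsmul_eq_mul]
      linarith
    refine ⟨fun i => if i < N then f i else y, fun i => ?_, ?_⟩
    · dsimp only; split_ifs
      · exact hf i
      · exact hy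
    · have hsub : (X.filter fun x => ∀ i < N + 1, ¬rel x (if i < N then f i else y)) ⊆
          U.filter fun x => ¬rel x y := by
        intro x hx
        simp only [hU, Finset.mem_filter] at hx ⊢
        refine ⟨⟨hx.1, fun i hi => ?_⟩, ?_⟩
        · simpa [hi] using hx.2 i (by omega)
        · simpa using hx.2 N (by omega)
      have hcard : ((U.filter fun x => rel x y).card : ℝ) + (U.filter fun x => ¬rel x y).card =
          U.card := by
        exact_mod_cast Finset.card_filter_add_card_filter_not (s := U) fun x => rel x y
      have h₁ : ((U.filter fun x => ¬rel x y).card : ℝ) ≤ (1 - ρ) * U.card := by linarith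
      have h₂ : ρ ≤ 1 ∨ U.card = 0 := by
        rcases U.eq_empty_or_nonempty with h | ⟨x, hx⟩
        · right; simp [h]
        · left
          have h₃ := hρ x (Finset.mem_of_mem_filter x hx)
          have h₄ : ((Y.filter fun y => rel x y).card : ℝ) ≤ Y.card := by
            exact_mod_cast Finset.card_filter_le _ _
          exact le_of_mul_le_mul_right (by linarith) hYpos
      refine (Nat.cast_le.2 (Finset.card_le_card hsub)).trans (h₁.trans ?_)
      rcases h₂ with h₂ | h₂
      · calc (1 - ρ) * (U.card : ℝ) ≤ (1 - ρ) * (X.card * (1 - ρ) ^ N) :=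
              mul_le_mul_of_nonneg_left hle (by linarith)
          _ = _ := by ring
      · have h₃ : (U.filter fun x => ¬rel x y).card ≤ 0 := (Finset.card_filter_le _ _).trans h₂.le
        rw [h₂] at hle ⊢
        -- For `ρ > 1` the power could be negative, but then the hypothesis forces `X` to be empty.
        by_cases hρ1 : ρ ≤ 1
        · have : (0 : ℝ) ≤ 1 - ρ := by linarith
          simp only [Nat.cast_zero, mul_zero]; positivity
        · have hX : X = ∅ := by
            by_contra hne
            obtain ⟨x, hx⟩ := Finset.nonempty_iff_ne_empty.2 hne
            have h₃ := hρ x hx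
            have h₄ : ((Y.filter fun y => rel x y).card : ℝ) ≤ Y.card := by
              exact_mod_cast Finset.card_filter_le _ _
            exact hρ1 (le_of_mul_le_mul_right (by linarith) hYpos)
          simp [hX]

theorem choose_le_card_filter_superset {V : Finset ℕ} {Q : Finset ℕ} (hQ : Q ⊆ V) (s : ℕ) :
    (V.card - Q.card).choose s ≤
      ((V.powersetCard (Q.card + s)).filter fun T => Q ⊆ T).card := by
  rw [← Finset.card_sdiff_of_subset hQ, ← Finset.card_powersetCard]
  refine Finset.card_le_card_of_injOn (fun T => Q ∪ T) (fun T hT => ?_) fun T hT T' hT' h => ?_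
  · have hT := Finset.mem_powersetCard.1 hT
    have hdisj : Disjoint Q T :=
      Finset.disjoint_of_subset_right hT.1 Finset.disjoint_sdiff
    simp only [Finset.coe_filter, Set.mem_ofPred_eq, Finset.mem_powersetCard]
    refine ⟨⟨Finset.union_subset hQ (hT.1.trans Finset.sdiff_subset), ?_⟩,
      Finset.subset_union_left⟩
    rw [Finset.card_union_of_disjoint hdisj, hT.2]
  · have hT := Finset.mem_powersetCard.1 hT
    have hT' := Finset.mem_powersetCard.1 hT'
    have hdisj : Disjoint Q T := Finset.disjoint_of_subset_right hT.1 Finset.disjoint_sdiff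
    have hdisj' : Disjoint Q T' := Finset.disjoint_of_subset_right hT'.1 Finset.disjoint_sdiff
    have h' : (Q ∪ T) \ Q = (Q ∪ T') \ Q := congrArg (· \ Q) h
    rwa [Finset.union_sdiff_cancel_left hdisj, Finset.union_sdiff_cancel_left hdisj'] at h'

/-- There are few sets of size `2 * k` such that every set of size `k` lies in one of them. -/
theorem exists_covering_design {k t N : ℕ} (hkt : k ≤ t)
    (hN : ((2 * t).choose k : ℝ) / (2 * k).choose k * (1 + Real.log ((2 * t).choose k)) ≤ N) :
    ∃ f : ℕ → Finset ℕ, (∀ i, (f i).card = 2 * k) ∧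
      ∀ Q ⊆ Finset.range (2 * t), Q.card = k → ∃ i < N, Q ⊆ f i := by
  set V := Finset.range (2 * t) with hV
  have hVc : V.card = 2 * t := Finset.card_range _
  have hApos : 0 < (2 * t).choose k := Nat.choose_pos (by omega)
  have hDpos : 0 < (2 * k).choose k := Nat.choose_pos (by omega)
  -- This is the proportion of `2 * k`-sets that contain a given `k`-set: `hmul'` identifies it with
  -- `(2t - k choose k) / (2t choose 2k)`.
  set ρ : ℝ := ((2 * k).choose k : ℝ) / (2 * t).choose k with hρ
  have hY : (V.powersetCard (2 * k)).Nonempty := by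
    rw [Finset.powersetCard_nonempty, hVc]; omega
  have hmul := Nat.choose_mul (n := 2 * t) (k := 2 * k) (s := k) (by omega)
  have hmul' : ((2 * t).choose (2 * k) : ℝ) * (2 * k).choose k =
      (2 * t).choose k * (2 * t - k).choose k := by
    have : 2 * k - k = k := by omega
    rw [this] at hmul
    exact_mod_cast hmul
  have hprop : ∀ Q ∈ V.powersetCard k, ρ * (V.powersetCard (2 * k)).card ≤
      (((V.powersetCard (2 * k)).filter fun T => Q ⊆ T).card : ℝ) := by
    intro Q hQ
    obtain ⟨hQV, hQc⟩ := Finset.mem_powersetCard.1 hQ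
    have h₁ := choose_le_card_filter_superset hQV k
    rw [hQc, hVc, ← two_mul] at h₁
    refine le_trans (le_of_eq ?_) (Nat.cast_le.2 h₁)
    rw [Finset.card_powersetCard, hVc, hρ]
    have : ((2 * t).choose k : ℝ) ≠ 0 := by exact_mod_cast hApos.ne'
    field_simp
    linarith
  obtain ⟨f, hf, hle⟩ := exists_greedy_cover (V.powersetCard k) (V.powersetCard (2 * k)) hY
    (fun Q T => Q ⊆ T) hprop N
  refine ⟨f, fun i => (Finset.mem_powersetCard.1 (hf i)).2, fun Q hQ hQc => ?_⟩
  by_contra hno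
  push Not at hno
  have hA : (0 : ℝ) < (2 * t).choose k := by exact_mod_cast hApos
  have hD : (0 : ℝ) < (2 * k).choose k := by exact_mod_cast hDpos
  have h₁ : (1 : ℝ) ≤ (((V.powersetCard k).filter fun Q => ∀ i < N, ¬Q ⊆ f i).card : ℝ) := by
    have : 0 < ((V.powersetCard k).filter fun Q => ∀ i < N, ¬Q ⊆ f i).card :=
      Finset.card_pos.2 ⟨Q, Finset.mem_filter.2 ⟨Finset.mem_powersetCard.2 ⟨hQ, hQc⟩, hno⟩⟩
    exact_mod_cast this
  have hρpos : 0 < ρ := div_pos hD hA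
  have hρ1 : ρ ≤ 1 := by
    rw [hρ, div_le_one hA]
    exact_mod_cast Nat.choose_le_choose k (by omega)
  have h₂ : (1 - ρ) ^ N ≤ Real.exp (-(ρ * N)) := by
    calc (1 - ρ) ^ N ≤ Real.exp (-ρ) ^ N :=
          pow_le_pow_left₀ (by linarith) (Real.one_sub_le_exp_neg ρ) N
      _ = Real.exp (-(ρ * N)) := by rw [← Real.exp_nat_mul]; congr 1; ring
  -- By the choice of `N`, at most `exp (-1)` sets remain uncovered, hence none.
  have h₃ : 1 + Real.log ((2 * t).choose k) ≤ ρ * N := by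
    have := mul_le_mul_of_nonneg_left hN hρpos.le
    rwa [← mul_assoc, hρ, div_mul_div_cancel₀ hA.ne', div_self hD.ne', one_mul] at this
  have h₄ : Real.exp (-(ρ * N)) ≤ Real.exp (-1) * ((2 * t).choose k : ℝ)⁻¹ := by
    rw [show ((2 * t).choose k : ℝ)⁻¹ = Real.exp (-Real.log ((2 * t).choose k)) by
      rw [Real.exp_neg, Real.exp_log hA], ← Real.exp_add]
    exact Real.exp_le_exp.2 (by linarith)
  rw [Finset.card_powersetCard, hVc] at hle
  have h₅ : ((2 * t).choose k : ℝ) * (1 - ρ) ^ N ≤ Real.exp (-1) := by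
    calc ((2 * t).choose k : ℝ) * (1 - ρ) ^ N
        ≤ (2 * t).choose k * (Real.exp (-1) * ((2 * t).choose k : ℝ)⁻¹) :=
          mul_le_mul_of_nonneg_left (h₂.trans h₄) hA.le
      _ = Real.exp (-1) := by field_simp
  have h₆ : Real.exp (-1) < 1 := by
    rw [← Real.exp_zero]; exact Real.exp_lt_exp.2 (by norm_num)
  linarith

namespace ParityRAM

/-! ### From block designs to sets of coordinates. -/

/-- There are few sets of coordinates, of size little more than `k * n / t`, such that every set of
`k` coordinates lies in one of them. -/
theorem exists_cover {k t N : ℕ} (n : ℕ) (hkt : k ≤ t) (ht : 1 ≤ t)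
    (hN : ((2 * t).choose k : ℝ) / (2 * k).choose k * (1 + Real.log ((2 * t).choose k)) ≤ N) :
    ∃ C : ℕ → Finset (Fin n), (∀ i, (C i).card ≤ 2 * k * (n / (2 * t) + 1)) ∧
      ∀ x : Fin n → ZMod 2, hammingNorm x = k → ∃ i < N, ∀ r, x r ≠ 0 → r ∈ C i := by
  obtain ⟨f, hf, hcov⟩ := exists_covering_design hkt hN
  -- Coordinate `r` lies in block `r / L`. Since `n < 2 * t * L`, there are at most `2 * t` blocks.
  set L := n / (2 * t) + 1 with hL
  refine ⟨fun i => Finset.univ.filter fun r : Fin n => (r : ℕ) / L ∈ f i, fun i => ?_,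
    fun x hx => ?_⟩
  · have hLpos : 0 < L := Nat.succ_pos _
    rw [← hf i, mul_comm]
    refine Finset.card_le_mul_card_image_of_maps_to (f := fun r : Fin n => (r : ℕ) / L)
      (fun r hr => (Finset.mem_filter.1 hr).2) L fun q _ => ?_
    refine (Finset.card_le_card_of_injOn (t := Finset.range L) (fun r : Fin n => (r : ℕ) % L) (fun r _ => ?_) ?_).trans_eq (Finset.card_range L)
    · exact Finset.mem_coe.2 (Finset.mem_range.2 (Nat.mod_lt _ hLpos))
    · intro r hr r' hr' h
      have h₁ := (Finset.mem_filter.1 hr).2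
      have h₂ := (Finset.mem_filter.1 hr').2
      have h₃ : (r : ℕ) % L = (r' : ℕ) % L := h
      have h₄ : (r : ℕ) / L = (r' : ℕ) / L := h₁.trans h₂.symm
      apply Fin.ext
      rw [← Nat.div_add_mod (r : ℕ) L, ← Nat.div_add_mod (r' : ℕ) L, h₃, h₄]
  · have hcard : ((Finset.univ.filter fun r => x r ≠ 0).image fun r : Fin n => (r : ℕ) / L).card
        ≤ k := Finset.card_image_le.trans_eq hx
    have hsub : ((Finset.univ.filter fun r => x r ≠ 0).image fun r : Fin n => (r : ℕ) / L) ⊆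
        Finset.range (2 * t) := by
      intro q hq
      obtain ⟨r, _, rfl⟩ := Finset.mem_image.1 hq
      refine Finset.mem_range.2 (Nat.div_lt_of_lt_mul ?_)
      have := Nat.lt_mul_div_succ n (by omega : 0 < 2 * t)
      calc (r : ℕ) < n := r.2
        _ < 2 * t * L := this
        _ = L * (2 * t) := mul_comm _ _
    -- The support may meet fewer than `k` blocks, so the set of blocks is first enlarged to size
    -- `k`.
    obtain ⟨Q, hQ₁, hQ₂, hQ₃⟩ := Finset.exists_subsuperset_card_eq hsub hcard
      (by rw [Finset.card_range]; omega)
    obtain ⟨i, hi, hQi⟩ := hcov Q hQ₂ hQ₃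
    refine ⟨i, hi, fun r hr => Finset.mem_filter.2 ⟨Finset.mem_univ r, hQi (hQ₁ ?_)⟩⟩
    exact Finset.mem_image_of_mem _ (Finset.mem_filter.2 ⟨Finset.mem_univ r, hr⟩)

/-- Unused positions receive the index `n`, which is out of range, so `coord` is 0 there. -/
theorem exists_enumeration {n m : ℕ} (C : Finset (Fin n)) (hC : C.card ≤ m) :
    ∃ s : ℕ → ℕ, (∀ l, s l ≤ n) ∧ ∀ x : Fin n → ZMod 2, (∀ r, x r ≠ 0 → r ∈ C) →
      ∃ z : ℕ → ZMod 2, ∀ a : Fin n → ZMod 2,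
        ∑ l ∈ Finset.range m, (coord a (s l) : ZMod 2) * z l = a ⬝ᵥ x := by
  let e := C.equivFin
  refine ⟨fun l => if h : l < C.card then (e.symm ⟨l, h⟩ : Fin n) else n, fun l => ?_,
    fun x hx => ⟨fun l => if h : l < C.card then x (e.symm ⟨l, h⟩) else 0, fun a => ?_⟩⟩
  · dsimp only; split_ifs
    · exact (Fin.is_lt _).le
    · exact le_rfl
  · have h₁ : a ⬝ᵥ x = ∑ r ∈ C, a r * x r := by
      rw [dotProduct]
      symm
      refine Finset.sum_subset (Finset.subset_univ C) fun r _ hr => ?_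
      have : x r = 0 := by by_contra hne; exact hr (hx r hne)
      rw [this, mul_zero]
    have h₂ : ∑ r ∈ C, a r * x r = ∑ l : Fin C.card, a (e.symm l) * x (e.symm l) := by
      rw [← Finset.sum_coe_sort]
      exact (Equiv.sum_comp e.symm fun r : C => a r * x r).symm
    rw [h₁, h₂, ← Finset.sum_subset (Finset.range_mono hC) (fun l _ hl => by
      have hl' : ¬l < C.card := fun h => hl (Finset.mem_range.2 h)
      simp [hl']), Finset.sum_range]
    refine Finset.sum_congr rfl fun l _ => ?_
    simp [coord]

/-- If every set of `k` coordinates lies in one of `N` sets of at most `m` coordinates, then the class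
of parities can be learned with at most `m + log₂ N` mistakes. -/
theorem exists_learner_of_finset_cover {N m n k : ℕ} (hN : 1 ≤ N) (C : ℕ → Finset (Fin n))
    (hC : ∀ i, (C i).card ≤ m)
    (hcov : ∀ x : Fin n → ZMod 2, hammingNorm x = k → ∃ i < N, ∀ r, x r ≠ 0 → r ∈ C i) :
    ∃ P : Program, P.size ≤ 51000 * (N * (m + 1) ^ 2) * len (N + m + n + 20) ∧
      LearnsParities P n k (m + Real.logb 2 N)
        (51000 * (N * (m + 1) ^ 2) * len (N + m + n + 20) : ℕ) := by
  choose s hs hz using fun i => exists_enumeration (C i) (hC i)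
  refine exists_learner_of_cover hN (fun i _ l _ => hs i l) fun x hx => ?_
  obtain ⟨i, hi, hxi⟩ := hcov x hx
  exact ⟨i, hi, hz i x hxi⟩

end ParityRAM

/-! ### Estimates -/

/-- The comparison is factor by factor: `2 * t - j ≤ 21 / 10 * (t - j)` amounts to `11 * j ≤ t`. -/
theorem descFactorial_two_mul_le {k t : ℕ} (h : 11 * k ≤ t) :
    ((2 * t).descFactorial k : ℝ) ≤ (21 / 10 : ℝ) ^ k * t.descFactorial k := by
  induction k with
  | zero => simp
  | succ k ih =>
    rw [Nat.descFactorial_succ, Nat.descFactorial_succ, Nat.cast_mul, Nat.cast_mul,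
      Nat.cast_sub (by omega), Nat.cast_sub (by omega)]
    have h₁ : (11 * (k + 1) : ℝ) ≤ t := by exact_mod_cast h
    have h₂ : ((2 * t : ℕ) : ℝ) - k ≤ 21 / 10 * (t - k) := by push_cast; linarith
    have hk : (0 : ℝ) ≤ k := Nat.cast_nonneg k
    have h₃ : (0 : ℝ) ≤ 21 / 10 * (t - k) := by linarith
    calc (((2 * t : ℕ) : ℝ) - k) * (2 * t).descFactorial k
        ≤ (21 / 10 * (t - k)) * ((21 / 10 : ℝ) ^ k * t.descFactorial k) :=
          mul_le_mul h₂ (ih (by omega)) (Nat.cast_nonneg _) h₃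
      _ = _ := by ring

theorem choose_two_mul_le {k t : ℕ} (h : 11 * k ≤ t) :
    ((2 * t).choose k : ℝ) ≤ (21 / 10 : ℝ) ^ k * t.choose k := by
  have h₁ := descFactorial_two_mul_le h
  rw [Nat.descFactorial_eq_factorial_mul_choose, Nat.descFactorial_eq_factorial_mul_choose,
    Nat.cast_mul, Nat.cast_mul] at h₁
  have hf : (0 : ℝ) < k.factorial := by exact_mod_cast k.factorial_pos
  refine le_of_mul_le_mul_left ?_ hf
  linarith

/-- Passing from `t` to `2 * t` blocks costs at most `(21 / 10) ^ k`, but using `2 * k` of them at a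
time gains `4 ^ k / (2 * k + 1)`. The net base is `21 / 40`. -/
theorem choose_div_centralBinom_le {k t : ℕ} (h : 11 * k ≤ t) :
    ((2 * t).choose k : ℝ) / (2 * k).choose k ≤
      (2 * k + 1) * (21 / 40 : ℝ) ^ k * t.choose k := by
  have hD : (0 : ℝ) < (2 * k).choose k := by exact_mod_cast Nat.choose_pos (by omega)
  have h₁ : (4 : ℝ) ^ k ≤ (2 * k + 1) * (2 * k).choose k := by
    exact_mod_cast Nat.four_pow_le_two_mul_add_one_mul_central_binom k
  rw [div_le_iff₀ hD]
  calc ((2 * t).choose k : ℝ) ≤ (21 / 10 : ℝ) ^ k * t.choose k := choose_two_mul_le h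
    _ = (21 / 40 : ℝ) ^ k * t.choose k * 4 ^ k := by
        rw [show (21 / 10 : ℝ) = 21 / 40 * 4 by norm_num, mul_pow]; ring
    _ ≤ (21 / 40 : ℝ) ^ k * t.choose k * ((2 * k + 1) * (2 * k).choose k) := by gcongr
    _ = _ := by ring

theorem log_choose_le {k t n : ℕ} (hk : 1 ≤ k) (ht : 1 ≤ t) (htn : t ≤ n) (hkt : k ≤ 2 * t)
    (hn : 1 ≤ Real.log n) : 1 + Real.log ((2 * t).choose k) ≤ 3 * k * Real.log n := by
  have hpos : (0 : ℝ) < (2 * t).choose k := by exact_mod_cast Nat.choose_pos hkt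
  have htpos : (0 : ℝ) < t := by exact_mod_cast ht
  have htn' : (t : ℝ) ≤ n := by exact_mod_cast htn
  have h₁ : ((2 * t).choose k : ℝ) ≤ (2 * n : ℝ) ^ k := by
    refine (show ((2 * t).choose k : ℝ) ≤ (2 * t : ℝ) ^ k by
      exact_mod_cast Nat.choose_le_pow (2 * t) k).trans ?_
    gcongr
  have h₂ : Real.log ((2 * t).choose k) ≤ k * (Real.log 2 + Real.log n) := by
    rw [← Real.log_mul (by norm_num) (by linarith), ← Real.log_pow]
    exact Real.log_le_log hpos h₁
  have h₃ : Real.log 2 ≤ 1 := by linarith [Real.log_two_lt_d9]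
  have hk' : (1 : ℝ) ≤ k := by exact_mod_cast hk
  nlinarith

/-- The numerical reason is `e < (4 / 3) ^ 4`. -/
theorem exp_quarter_le : Real.exp (1 / 4.01) ≤ 4 / 3 := by
  have h₁ : Real.exp (1 / 4.01) ≤ Real.exp (1 / 4) := Real.exp_le_exp.2 (by norm_num)
  refine h₁.trans ?_
  have h₂ : Real.exp (1 / 4) ^ 4 ≤ (4 / 3 : ℝ) ^ 4 := by
    rw [← Real.exp_nat_mul]
    have := Real.exp_one_lt_d9
    norm_num at this ⊢
    linarith
  exact le_of_pow_le_pow_left₀ (by norm_num) (by norm_num) h₂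

namespace ParityRAM

/-! ### Size of the covering and cost of a round in terms of `n`, `k` and `t`. -/

theorem len_le_log {N m n k : ℕ} (hk : 1 ≤ k) (hn : 30 ≤ n) (hlog : 1 ≤ Real.log n)
    (hN : N ≤ n ^ k) (hm : m ≤ 3 * n ^ 2) :
    (len (N + m + n + 20) : ℝ) ≤ 11 * k * Real.log n := by
  have h₁ : N + m + n + 20 ≤ n ^ (k + 4) := by
    have h1 : 1 ≤ n ^ k := Nat.one_le_pow _ _ (by omega)
    have h2 : 2 ≤ n ^ 4 := (by omega : 2 ≤ n).trans (Nat.le_self_pow (by norm_num) n)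
    have h3 : m + n + 20 ≤ n ^ 3 := by nlinarith [Nat.mul_le_mul hn (le_refl (n ^ 2))]
    have h4 : 1 + n ^ 3 ≤ n ^ 4 := by nlinarith [Nat.mul_le_mul hn (le_refl (n ^ 3))]
    calc N + m + n + 20 ≤ n ^ k * 1 + n ^ k * n ^ 3 := by
          have := Nat.mul_le_mul h1 (le_refl (n ^ 3))
          omega
      _ = n ^ k * (1 + n ^ 3) := by ring
      _ ≤ n ^ k * n ^ 4 := Nat.mul_le_mul_left _ h4
      _ = n ^ (k + 4) := (pow_add _ _ _).symm
  have h₂ : (Nat.log 2 (N + m + n + 20) : ℝ) ≤ Real.logb 2 (N + m + n + 20 : ℕ) := by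
    exact_mod_cast Real.natLog_le_logb (N + m + n + 20) 2
  have h₃ : Real.log (N + m + n + 20 : ℕ) ≤ (k + 4) * Real.log n := by
    have : Real.log (N + m + n + 20 : ℕ) ≤ Real.log ((n : ℝ) ^ (k + 4)) :=
      Real.log_le_log (by positivity) (by exact_mod_cast h₁)
    rw [Real.log_pow] at this
    exact_mod_cast this
  have h₄ : Real.logb 2 (N + m + n + 20 : ℕ) ≤ 2 * ((k + 4) * Real.log n) := by
    rw [Real.logb, div_le_iff₀ (Real.log_pos (by norm_num))]
    have h5 : (1 / 2 : ℝ) ≤ Real.log 2 := by linarith [Real.log_two_gt_d9]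
    have h6 : 0 ≤ ((k : ℝ) + 4) * Real.log n := by positivity
    nlinarith
  have hk' : (1 : ℝ) ≤ k := by exact_mod_cast hk
  have hkl : (1 : ℝ) ≤ k * Real.log n := by nlinarith
  unfold len
  push_cast
  nlinarith

/-- The number of sets in the covering. -/
noncomputable def coverSize (k t : ℕ) : ℕ :=
  ⌈((2 * t).choose k : ℝ) / (2 * k).choose k * (1 + Real.log ((2 * t).choose k))⌉₊

theorem one_le_coverSize {k t : ℕ} (hkt : k ≤ t) : 1 ≤ coverSize k t := by
  have h₁ : (0 : ℝ) < (2 * t).choose k := by exact_mod_cast Nat.choose_pos (by omega)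
  have h₂ : (0 : ℝ) < (2 * k).choose k := by exact_mod_cast Nat.choose_pos (by omega)
  have h₃ : 0 ≤ Real.log ((2 * t).choose k) := Real.log_natCast_nonneg _
  exact Nat.ceil_pos.2 (by positivity)

/-- The factors `2 * k + 1 ≤ 3 * k` and `3 * k * log n` give 9. Rounding up at most doubles this, as
the quantity rounded is at least 1. -/
theorem coverSize_le {k t n : ℕ} (hk : 1 ≤ k) (hkt : 11 * k ≤ t) (htn : t ≤ n)
    (hn : 1 ≤ Real.log n) :
    (coverSize k t : ℝ) ≤ 18 * k ^ 2 * Real.log n * (21 / 40 : ℝ) ^ k * t.choose k := by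
  have h₁ : (0 : ℝ) < (2 * t).choose k := by exact_mod_cast Nat.choose_pos (by omega)
  have h₂ : (0 : ℝ) < (2 * k).choose k := by exact_mod_cast Nat.choose_pos (by omega)
  have h₃ : 0 ≤ Real.log ((2 * t).choose k) := Real.log_natCast_nonneg _
  have hk' : (1 : ℝ) ≤ k := by exact_mod_cast hk
  set A := ((2 * t).choose k : ℝ) / (2 * k).choose k * (1 + Real.log ((2 * t).choose k)) with hA
  have hA1 : 1 ≤ A := by
    have : 1 ≤ ((2 * t).choose k : ℝ) / (2 * k).choose k := by
      rw [one_le_div h₂]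
      exact_mod_cast Nat.choose_le_choose k (by omega)
    nlinarith
  have hA2 : A ≤ 9 * k ^ 2 * Real.log n * (21 / 40 : ℝ) ^ k * t.choose k := by
    calc A ≤ ((2 * k + 1) * (21 / 40 : ℝ) ^ k * t.choose k) * (3 * k * Real.log n) :=
          mul_le_mul (choose_div_centralBinom_le hkt)
            (log_choose_le hk (by omega) htn (by omega) hn) (by positivity) (by positivity)
      _ ≤ ((3 * k) * (21 / 40 : ℝ) ^ k * t.choose k) * (3 * k * Real.log n) := by
          gcongr; linarith
      _ = _ := by ring
  have h₄ := Nat.ceil_lt_add_one (by linarith : 0 ≤ A)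
  have h₅ : (coverSize k t : ℝ) < A + 1 := h₄
  linarith

/-- One power of `l = log n` comes from the number of sets and one from the number of digits. The
base `847 / 1000 = 4 / 3 * (11 / 10) ^ 2 * (21 / 40)` is below 1, so the polynomial factor in `k` is
harmless. -/
theorem rate_le {k : ℕ} {l : ℝ} (hl0 : 0 ≤ l) (hl : l ≤ (11 / 10 : ℝ) ^ k) :
    Real.exp (k / 4.01) * (k ^ 3 * l ^ 2 * (21 / 40 : ℝ) ^ k) ≤ k ^ 3 * (847 / 1000 : ℝ) ^ k := by
  have h₁ : Real.exp (k / 4.01) ≤ (4 / 3 : ℝ) ^ k := by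
    rw [show (k : ℝ) / 4.01 = k * (1 / 4.01) by ring, Real.exp_nat_mul]
    exact pow_le_pow_left₀ (Real.exp_pos _).le exp_quarter_le k
  calc Real.exp (k / 4.01) * (k ^ 3 * l ^ 2 * (21 / 40 : ℝ) ^ k)
      ≤ (4 / 3 : ℝ) ^ k * (k ^ 3 * ((11 / 10 : ℝ) ^ k) ^ 2 * (21 / 40 : ℝ) ^ k) := by gcongr
    _ = k ^ 3 * ((4 / 3) * (11 / 10) ^ 2 * (21 / 40) : ℝ) ^ k := by
        rw [mul_pow, mul_pow, ← pow_mul, ← pow_mul, mul_comm 2 k]; ring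
    _ = _ := by norm_num

/-- The number of coordinates in each set of the covering. -/
def coverDim (n k t : ℕ) : ℕ := 2 * k * (n / (2 * t) + 1)

theorem coverDim_le {n k t : ℕ} (ht : 1 ≤ t) : (coverDim n k t : ℝ) ≤ k * n / t + 2 * k := by
  have ht' : (0 : ℝ) < t := by exact_mod_cast ht
  have h : ((n / (2 * t) : ℕ) : ℝ) ≤ n / (2 * t) := by exact_mod_cast Nat.cast_div_le (α := ℝ)
  calc (coverDim n k t : ℝ) = 2 * k * (((n / (2 * t) : ℕ) : ℝ) + 1) := by
        simp [coverDim]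
    _ ≤ 2 * k * (n / (2 * t) + 1) := by gcongr
    _ = _ := by field_simp

theorem cost_le {k t n : ℕ} (hk : 1 ≤ k) (hkt : 11 * k ≤ t) (htn : t ≤ n) (hn30 : 30 ≤ n)
    (hn : 1 ≤ Real.log n) (hl : Real.log n ≤ (11 / 10 : ℝ) ^ k)
    (hdecay : (k : ℝ) ^ 3 * (847 / 1000 : ℝ) ^ k ≤ 1) (hcover : coverSize k t ≤ t.choose k) :
    Real.exp (k / 4.01) / t.choose k * (51000 * (coverSize k t * (coverDim n k t + 1) ^ 2) *
      len (coverSize k t + coverDim n k t + n + 20)) ≤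
      51000 * 18 * 16 * 11 * (k * n / t : ℝ) ^ 2 := by
  have ht' : (1 : ℝ) ≤ t := by exact_mod_cast (by omega : 1 ≤ t)
  have hk' : (1 : ℝ) ≤ k := by exact_mod_cast hk
  have htn' : (t : ℝ) ≤ n := by exact_mod_cast htn
  have hC : (0 : ℝ) < t.choose k := by exact_mod_cast Nat.choose_pos (by omega)
  have hNn : coverSize k t ≤ n ^ k :=
    hcover.trans ((Nat.choose_le_pow t k).trans (Nat.pow_le_pow_left htn k))
  have hmn : coverDim n k t ≤ 3 * n ^ 2 := by
    have h₁ : n / (2 * t) ≤ n / 2 := Nat.div_le_div_left (by omega) (by norm_num)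
    have h₂ : n / (2 * t) + 1 ≤ n := by omega
    calc coverDim n k t ≤ 2 * n * n := Nat.mul_le_mul (by omega) h₂
      _ ≤ 3 * n ^ 2 := by nlinarith
  have hlen := len_le_log hk hn30 hn hNn hmn
  have hsize := coverSize_le hk hkt htn hn
  have hq : (k : ℝ) ≤ k * n / t := by
    rw [le_div_iff₀ (by linarith)]; gcongr
  -- Here `k * n / t + 2 * k + 1` is at most four times `k * n / t`, because `1 ≤ k ≤ k * n / t`.
  have hdim : (coverDim n k t : ℝ) + 1 ≤ 4 * (k * n / t) := by
    have := coverDim_le (n := n) (k := k) (by omega : 1 ≤ t)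
    linarith
  have hrate := (rate_le (by linarith) hl).trans hdecay
  have hlog0 : 0 ≤ Real.log n := by linarith
  calc Real.exp (k / 4.01) / t.choose k * (51000 * (coverSize k t * (coverDim n k t + 1) ^ 2) *
        len (coverSize k t + coverDim n k t + n + 20))
      ≤ Real.exp (k / 4.01) / t.choose k *
        (51000 * ((18 * k ^ 2 * Real.log n * (21 / 40 : ℝ) ^ k * t.choose k) *
          (4 * (k * n / t)) ^ 2) * (11 * k * Real.log n)) := by gcongr
    _ = 51000 * 18 * 16 * 11 * (k * n / t : ℝ) ^ 2 *
        (Real.exp (k / 4.01) * (k ^ 3 * Real.log n ^ 2 * (21 / 40 : ℝ) ^ k)) := by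
        field_simp; ring
    _ ≤ 51000 * 18 * 16 * 11 * (k * n / t : ℝ) ^ 2 * 1 := by gcongr
    _ = _ := mul_one _

theorem coverSize_le_choose {k t n : ℕ} (hk : 1 ≤ k) (hkt : 11 * k ≤ t) (htn : t ≤ n)
    (hn : 1 ≤ Real.log n) (hl : Real.log n ≤ (11 / 10 : ℝ) ^ k)
    (hdecay : 18 * ((k : ℝ) ^ 2 * (231 / 400 : ℝ) ^ k) ≤ 1) : coverSize k t ≤ t.choose k := by
  have h₁ : 18 * (k : ℝ) ^ 2 * Real.log n * (21 / 40 : ℝ) ^ k ≤ 1 := by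
    refine le_trans ?_ hdecay
    calc 18 * (k : ℝ) ^ 2 * Real.log n * (21 / 40 : ℝ) ^ k
        ≤ 18 * (k : ℝ) ^ 2 * (11 / 10 : ℝ) ^ k * (21 / 40 : ℝ) ^ k := by gcongr
      _ = 18 * ((k : ℝ) ^ 2 * ((11 / 10) * (21 / 40) : ℝ) ^ k) := by rw [mul_pow]; ring
      _ = _ := by norm_num
  have h₂ := coverSize_le hk hkt htn hn
  have h₃ : (coverSize k t : ℝ) ≤ 1 * t.choose k := h₂.trans (by gcongr)
  rw [one_mul] at h₃
  exact_mod_cast h₃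

/-- For every `n` there is a learning algorithm; for `n` with `coverSize k t ≤ t.choose k`, it is the one
that is obtained from the covering. -/
theorem exists_learner_of_le {n k t : ℕ} (hkt : k ≤ t) :
    ∃ (P : Program) (δ τ : ℝ), (P.size : ℝ) ≤ τ ∧
      LearnsParities P n k ((1 + δ) * (k * n / t) + Real.logb 2 (t.choose k)) τ ∧
      (1 ≤ k → 1 ≤ n → coverSize k t ≤ t.choose k → δ = 2 * t / n ∧
        τ = 51000 * (coverSize k t * (coverDim n k t + 1) ^ 2) *
          len (coverSize k t + coverDim n k t + n + 20)) := by
  have mono : ∀ {P : Program} {M M' τ : ℝ}, M ≤ M' → LearnsParities P n k M τ →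
      LearnsParities P n k M' τ := by
    intro P M M' τ hM h x hx a
    obtain ⟨c, b, T, h₁, h₂, h₃, h₄⟩ := h x hx a
    exact ⟨c, b, T, h₁, h₂, h₃, fun r => (h₄ r).trans hM⟩
  have hC : (1 : ℝ) ≤ t.choose k := by exact_mod_cast Nat.choose_pos hkt
  have hlogC : 0 ≤ Real.logb 2 (t.choose k : ℝ) := Real.logb_nonneg (by norm_num) hC
  rcases Nat.eq_zero_or_pos k with rfl | hk
  · obtain ⟨P, hP, hl⟩ := exists_learner_of_finset_cover (N := 1) (m := 0) (n := n) (k := 0) le_rfl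
      (fun _ => ∅) (fun _ => by simp) fun x hx => ⟨0, one_pos, fun r hr =>
        (hr (by rw [hammingNorm_eq_zero.1 hx]; rfl)).elim⟩
    exact ⟨P, 0, _, Nat.cast_le.2 hP, mono (by simp) hl, fun h => absurd h (by norm_num)⟩
  have ht : 1 ≤ t := by omega
  have ht' : (1 : ℝ) ≤ t := by exact_mod_cast ht
  have hk' : (1 : ℝ) ≤ k := by exact_mod_cast hk
  by_cases hgood : 1 ≤ n ∧ coverSize k t ≤ t.choose k
  · obtain ⟨hn, hcs⟩ := hgood
    obtain ⟨C, hCcard, hcov⟩ := exists_cover n hkt ht (Nat.le_ceil _)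
    obtain ⟨P, hP, hl⟩ := exists_learner_of_finset_cover (one_le_coverSize hkt) C hCcard hcov
    refine ⟨P, 2 * t / n, _, Nat.cast_le.2 hP, mono ?_ hl, fun _ _ _ => ⟨rfl, ?_⟩⟩
    · have hn' : (0 : ℝ) < n := by exact_mod_cast hn
      have h₁ : (1 + 2 * t / n : ℝ) * (k * n / t) = k * n / t + 2 * k := by
        field_simp
      rw [h₁]
      have h₂ : (0 : ℝ) < coverSize k t := by exact_mod_cast one_le_coverSize hkt
      exact add_le_add (coverDim_le ht)
        (Real.logb_le_logb_of_le (by norm_num) h₂ (by exact_mod_cast hcs))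
    · push_cast [coverDim]; rfl
  -- Otherwise a single set of all coordinates gives at most `n` mistakes. Since `n ≤ k * n`, the
  -- slack `δ = t` suffices.
  · obtain ⟨P, hP, hl⟩ := exists_learner_of_finset_cover (N := 1) (m := n) (n := n) (k := k) le_rfl
      (fun _ => Finset.univ) (fun _ => by simp) fun x hx => ⟨0, one_pos, fun r _ =>
        Finset.mem_univ r⟩
    refine ⟨P, t, _, Nat.cast_le.2 hP, mono ?_ hl, fun _ h₁ h₂ => (hgood ⟨h₁, h₂⟩).elim⟩
    have h₁ : (1 + t : ℝ) * (k * n / t) = k * n / t + k * n := by field_simp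
    have h₂ : (n : ℝ) ≤ k * n := le_mul_of_one_le_left (Nat.cast_nonneg n) hk'
    have h₃ : (0 : ℝ) ≤ k * n / t := by positivity
    rw [h₁, Nat.cast_one, Real.logb_one]
    linarith

end ParityRAM

/-! ### Asymptotics and conclusion. -/

theorem mainTheorem1 (k t : ℕ → ℕ)
    (hk : (fun n : ℕ => Real.log (Real.log (n : ℝ))) =o[atTop] fun n : ℕ => (k n : ℝ))
    (hkt : (fun n : ℕ => (k n : ℝ)) =o[atTop] fun n : ℕ => (t n : ℝ))
    (htn : (fun n : ℕ => (t n : ℝ)) =o[atTop] fun n : ℕ => (n : ℝ)) :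
    ∃ (P : ℕ → ParityRAM.Program) (ε g : ℕ → ℝ),
      Tendsto ε atTop (𝓝 0) ∧
      IsSoftO g (fun n : ℕ => ((k n : ℝ) * (n : ℝ) / (t n : ℝ)) ^ 2) ∧
      ∀ n : ℕ, k n ≤ t n →
        ParityRAM.LearnsParities (P n) n (k n)
          ((1 + ε n) * ((k n : ℝ) * (n : ℝ) / (t n : ℝ))
            + Real.logb 2 ((t n).choose (k n) : ℝ))
          (Real.exp (-(k n : ℝ) / 4.01) * ((t n).choose (k n) : ℝ) * g n) ∧
        ((P n).size : ℝ) ≤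
          Real.exp (-(k n : ℝ) / 4.01) * ((t n).choose (k n) : ℝ) * g n := by
  choose P δ τ hsize hlearn hgood using
    fun n (h : k n ≤ t n) => ParityRAM.exists_learner_of_le (n := n) h
  have hlog : Tendsto (fun n : ℕ => Real.log (n : ℝ)) atTop atTop :=
    Real.tendsto_log_atTop.comp tendsto_natCast_atTop_atTop
  have hloglog : Tendsto (fun n : ℕ => Real.log (Real.log (n : ℝ))) atTop atTop :=
    Real.tendsto_log_atTop.comp hlog
  have hkinf : Tendsto k atTop atTop := by
    rw [← tendsto_natCast_atTop_iff (R := ℝ)]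
    refine tendsto_atTop_mono' atTop ?_ hloglog
    filter_upwards [hk.bound one_pos] with n hn
    simpa using (le_abs_self _).trans hn
  have hev : ∀ᶠ n : ℕ in atTop, 1 ≤ k n ∧ 11 * k n ≤ t n ∧ t n ≤ n ∧ 30 ≤ n ∧
      1 ≤ Real.log n ∧ ParityRAM.coverSize (k n) (t n) ≤ (t n).choose (k n) ∧
      Real.log n ≤ (11 / 10 : ℝ) ^ k n ∧ (k n : ℝ) ^ 3 * (847 / 1000 : ℝ) ^ k n ≤ 1 := by
    have h₁ := (tendsto_pow_const_mul_const_pow_of_abs_lt_one 3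
      (by norm_num [abs_of_pos] : |(847 / 1000 : ℝ)| < 1)).comp hkinf
    have h₂ := (tendsto_pow_const_mul_const_pow_of_abs_lt_one 2
      (by norm_num [abs_of_pos] : |(231 / 400 : ℝ)| < 1)).comp hkinf
    have hlog11 : 0 < Real.log (11 / 10) := Real.log_pos (by norm_num)
    filter_upwards [h₁.eventually_le_const one_pos,
      h₂.eventually_le_const (by norm_num : (0 : ℝ) < 1 / 18), hkinf.eventually_ge_atTop 1,
      hkt.bound (by norm_num : (0 : ℝ) < 1 / 11), htn.bound one_pos, eventually_ge_atTop 30,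
      hlog.eventually_ge_atTop 1, hk.bound hlog11] with n e₁ e₂ e₃ e₄ e₅ e₆ e₇ e₈
    simp only [Real.norm_natCast, one_mul] at e₄ e₅
    have f₁ : 11 * k n ≤ t n := by
      have : (11 * k n : ℝ) ≤ t n := by linarith
      exact_mod_cast this
    have f₂ : t n ≤ n := by exact_mod_cast e₅
    -- Exponentiating `log (log n) ≤ log (11 / 10) * k` gives the bound; this is the use of `log log
    -- n = o(k)` that absorbs the logarithms.
    have f₃ : Real.log n ≤ (11 / 10 : ℝ) ^ k n := by
      rw [Real.norm_natCast] at e₈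
      have e₉ := (le_abs_self _).trans e₈
      rw [mul_comm, ← Real.log_pow] at e₉
      exact (Real.log_le_log_iff (by linarith) (by positivity)).1 e₉
    refine ⟨e₃, f₁, f₂, e₆, e₇, ParityRAM.coverSize_le_choose e₃ f₁ f₂ e₇ f₃ ?_, f₃, e₁⟩
    simp only [Function.comp_apply] at e₂
    linarith
  have hkey : ∀ᶠ n : ℕ in atTop, ∃ h : k n ≤ t n, δ n h = 2 * t n / n ∧
      Real.exp (k n / 4.01) / (t n).choose (k n) * τ n h ≤
        51000 * 18 * 16 * 11 * ((k n : ℝ) * n / t n) ^ 2 ∧ 0 ≤ τ n h := by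
    filter_upwards [hev] with n ⟨e₁, e₂, e₃, e₄, e₅, e₆, e₇, e₈⟩
    have h : k n ≤ t n := by omega
    obtain ⟨hδ, hτ⟩ := hgood n h e₁ (by omega) e₆
    refine ⟨h, hδ, ?_, (Nat.cast_nonneg _).trans (hsize n h)⟩
    rw [hτ]
    exact ParityRAM.cost_le e₁ e₂ e₃ e₄ e₅ e₇ e₈ e₆
  -- The function `g` is defined so that the required time bound equals `τ` exactly, also for small
  -- `n`. Its growth is then controlled by `hkey`, and no logarithmic factor is needed, so the
  -- exponent is 0.
  refine ⟨fun n => if h : k n ≤ t n then P n h else [], fun n => if h : k n ≤ t n then δ n h else 0,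
    fun n => if h : k n ≤ t n then Real.exp (k n / 4.01) / (t n).choose (k n) * τ n h else 0,
    ?_, ⟨0, ?_⟩, fun n h => ?_⟩
  -- Eventually `ε n = 2 * t / n`: relative to `k * n / t`, this accounts for the `2 * k`
  -- coordinates lost by rounding block lengths up.
  · have h₁ : Tendsto (fun n : ℕ => 2 * ((t n : ℝ) / n)) atTop (𝓝 (2 * 0)) :=
      htn.tendsto_div_nhds_zero.const_mul 2
    rw [mul_zero] at h₁
    refine h₁.congr' ?_
    filter_upwards [hkey] with n ⟨h, hδ, _⟩
    rw [dif_pos h, hδ, mul_div_assoc]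
  · refine IsBigO.of_bound (51000 * 18 * 16 * 11) ?_
    filter_upwards [hkey] with n ⟨h, _, hτ, hτ0⟩
    rw [dif_pos h, pow_zero, mul_one, Real.norm_of_nonneg (by positivity),
      Real.norm_of_nonneg (by positivity)]
    exact hτ
  · have hC : (t n).choose (k n) ≠ 0 := (Nat.choose_pos h).ne'
    have hcancel : Real.exp (-(k n : ℝ) / 4.01) * ((t n).choose (k n) : ℝ) *
        (Real.exp (k n / 4.01) / (t n).choose (k n) * τ n h) = τ n h := by
      rw [neg_div, Real.exp_neg]
      have : ((t n).choose (k n) : ℝ) ≠ 0 := by exact_mod_cast hC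
      have := Real.exp_ne_zero ((k n : ℝ) / 4.01)
      field_simp
    simp only [dif_pos h, hcancel]
    exact ⟨hlearn n h, hsize n h⟩
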